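/- **Setting.** Let $L_2=\mathbb Z/2\wr\mathbb Z$ be the lamplighter group, with $t$ the generator of $\mathbb Z$ and $a$ the generator of $\mathbb Z/2$; let $\exp_t:L_2\to\mathbb Z$ be the homomorphism with $a\mapsto0$, $t\mapsto1$. An element of $L_2$ is a lamp stand: finitely many lit lamps in a row indexed by $\mathbb Z$, and a position of the lamplighter. Let $T_0,T_1$ be copies of the $3$-valent tree, oriented so that each vertex has one predecessor and two successors, with height functions $h_i$ and with distinguished ends $\omega_i$, the ends reached by following predecessors. The Diestel–Leader graph $\mathrm{DL}_2(2)$ has as vertices the pairs $(x_0,x_1)$ with $h_0(x_0)+h_1(x_1)=0$; two of them are adjacent if both coordinates are. It is the Cayley graph of $L_2$ with respect to $\{t,at\}$: the lamplighter is at position $h_0(x_0)$, the lamps at smaller positions are encoded by $x_0$ and the other ones by $x_1$. So $L_2$ acts on $\mathrm{DL}_2(2)$ by left multiplication. Let $\partial\mathrm{DL}_2(2)$ be the set of asymptotic classes of geodesic rays of $\mathrm{DL}_2(2)$, with the induced action of $L_2$ and with the *unbased* topology: the quotient topology from the space of all geodesic rays with the topology of uniform convergence on compact sets. Every class contains rays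 from every vertex $p$; the quotient topology on the same set from the space of the rays emanating from $p$ is called the topology *based at $p$*. As a set, $\partial\mathrm{DL}_2(2)$ is the disjoint union of $\partial_+=(\partial T_0-\omega_0)\times\{\omega_1\}$ and $\partial_-=(\partial T_1-\omega_1)\times\{\omega_0\}$, according to the ends that the projections of a ray approach. A class has a lamp stand, the limit of the lamp stands along a ray, with the lamplighter at $+\infty$ (on $\partial_+$) or $-\infty$ (on $\partial_-$). If $\exp_t(g)\ne0$, then $g^{\infty}$ denotes the class whose lamps are the pointwise limit of those of $g^n$ as $n\to\infty$, with the lamplighter at $+\infty$ if $\exp_t(g)>0$ and at $-\infty$ if $\exp_t(g)<0$; and $g^{-\infty}=(g^{-1})^\infty$. For a topology on $\partial\mathrm{DL}_2(2)$, *$g$ acts with north-south dynamics with attractor $\alpha$ and repeller $\rho$* means: $\alpha\neq\rho$ are fixed by $g$; $g^n\xi\to\alpha$ for every $\xi\ne\rho$, and $g^{-n}\xi\to\rho$ for every $\xi\neq\alpha$, as $n\to\infty$; and for all open $U\ni\alpha$ and $V\ni\rho$ there is $N$ such that $g^n(V^c)\subseteq U$ and $g^{-n}(U^c)\subseteq V$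 for all $n\ge N$. (Limits need not be unique, as these topologies are not Hausdorff.) **Theorem.** Let $g\in L_2$ be nontrivial. 1. If $\exp_t(g)=0$, then $g$ acts on $\partial\mathrm{DL}_2(2)$ as a permutation of order $2$, and every point has minimal period $2$. 2. If $\exp_t(g)\neq0$, then $g^{\infty}$ and $g^{-\infty}$ are well defined (exactly one class each), and $g$ acts on $\partial\mathrm{DL}_2(2)$ (unbased topology) with north-south dynamics with attractor $g^\infty$ and repeller $g^{-\infty}$. If $\exp_t(g)>0$, then $g^\infty\in\partial_+$ and $g^{-\infty}\in\partial_-$; if $\exp_t(g)<0$, then $g^\infty\in\partial_-$ and $g^{-\infty}\in\partial_+$. 3. If $\exp_t(g)\ne0$, the following holds for the based topologies. For every vertex $p$, in the topology based at $p$, $g^n\xi\to g^\infty$ for every $\xi$ in the one of $\partial_\pm$ that contains $g^\infty$, and $g^{-n}\xi\to g^{-\infty}$ for every $\xi$ in the one that contains $g^{-\infty}$. Moreover $g$ acts with north-south dynamics with attractor $g^\infty$ and repeller $g^{-\infty}$ for the topology based at $p$ if and only if $g^{\infty}$ and $g^{-\infty}$ are both represented by rays from $p$ along which the heights are monotone,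 and there is a vertex $p$ (depending on $g$) with this property. -/

import Mathlib

open Filter Topology

noncomputable section

/-! ### Visual boundaries of graphs -/

section VisualBoundary

variable {V W : Type*}

/-- Geodesic rays issuing from vertices of a graph, recorded by the sequence of vertices through
which they pass. -/
def GeodRay (G : SimpleGraph V) : Type _ :=
  {γ : ℕ → V // ∀ m n : ℕ, m ≤ n → G.edist (γ m) (γ n) = ((n - m : ℕ) : ℕ∞)}

instance (G : SimpleGraph V) : CoeFun (GeodRay G) (fun _ => ℕ → V) := ⟨Subtype.val⟩

/-- Two rays are asymptotic if they stay at bounded distance from each other. -/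
def GeodRay.asymptotic (G : SimpleGraph V) : Setoid (GeodRay G) where
  r γ γ' := ∃ C : ℕ, ∀ n : ℕ, G.edist (γ n) (γ' n) ≤ (C : ℕ∞)
  iseqv :=
    { refl := fun γ => ⟨0, fun n => by simp⟩
      symm := fun {γ γ'} ⟨C, h⟩ => ⟨C, fun n => by rw [SimpleGraph.edist_comm]; exact h n⟩
      trans := fun {γ γ' γ''} ⟨C, h⟩ ⟨D, h'⟩ => ⟨C + D, fun n => by
        push_cast
        exact SimpleGraph.edist_triangle.trans (add_le_add (h n) (h' n))⟩ }

/-- The topology of uniform convergence on compact sets on the set of rays. As rays are recorded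
by their vertices and distinct vertices have distance at least `1`, this is the topology of
pointwise convergence, where the set of vertices is discrete: two rays are close if they share a
long initial segment. -/
instance (G : SimpleGraph V) : TopologicalSpace (GeodRay G) :=
  TopologicalSpace.induced (fun γ : GeodRay G => (γ : ℕ → V))
    (@Pi.topologicalSpace ℕ (fun _ => V) (fun _ => ⊥))

/-- The set of asymptotic classes of geodesic rays. -/
def VisualBoundary (G : SimpleGraph V) : Type _ := Quotient (GeodRay.asymptotic G)

/-- The asymptotic class of a ray. -/
def GeodRay.cls {G : SimpleGraph V} (γ : GeodRay G) : VisualBoundary G :=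
  Quotient.mk (GeodRay.asymptotic G) γ

/-- The topology of the (unbased) visual boundary: the quotient topology from the space of all
geodesic rays. -/
instance VisualBoundary.unbased (G : SimpleGraph V) : TopologicalSpace (VisualBoundary G) :=
  TopologicalSpace.coinduced (fun γ : GeodRay G => γ.cls) inferInstance

/-- The topology of the visual boundary based at `p`: the quotient topology from the space of the
geodesic rays emanating from `p` (meaningful if every class contains such a ray). -/
@[reducible] def VisualBoundary.based (G : SimpleGraph V) (p : V) : TopologicalSpace (VisualBoundary G) :=
  TopologicalSpace.coinduced (fun γ : {γ : GeodRay G // γ 0 = p} => γ.1.cls) inferInstance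

theorem edist_map_le {G : SimpleGraph V} {G' : SimpleGraph W} (f : G →g G') (u v : V) :
    G'.edist (f u) (f v) ≤ G.edist u v := by
  by_cases h : G.edist u v = ⊤
  · simp [h]
  · obtain ⟨w, hw⟩ := SimpleGraph.exists_walk_of_edist_ne_top h
    rw [← hw, ← SimpleGraph.Walk.length_map f w]
    exact SimpleGraph.edist_le _

theorem edist_map_iso {G : SimpleGraph V} {G' : SimpleGraph W} (f : G ≃g G') (u v : V) :
    G'.edist (f u) (f v) = G.edist u v := by
  apply le_antisymm (edist_map_le f.toHom u v)
  simpa using edist_map_le f.symm.toHom (f u) (f v)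

/-- The image of a ray under an automorphism of the graph. -/
def GeodRay.map {G : SimpleGraph V} (f : G ≃g G) (γ : GeodRay G) : GeodRay G :=
  ⟨fun n => f (γ n), fun m n h => by rw [edist_map_iso]; exact γ.2 m n h⟩

/-- The induced map on asymptotic classes. -/
def VisualBoundary.map {G : SimpleGraph V} (f : G ≃g G) : VisualBoundary G → VisualBoundary G :=
  Quotient.map (sa := GeodRay.asymptotic G) (sb := GeodRay.asymptotic G) (GeodRay.map f)
    (fun γ γ' ⟨C, h⟩ => ⟨C, fun n => by
      change G.edist (f (γ n)) (f (γ' n)) ≤ _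
      rw [edist_map_iso]; exact h n⟩)

end VisualBoundary

/-! ### The 3-valent tree with a distinguished end -/

/-- A vertex of the `3`-valent tree `T` in which each vertex has one predecessor and two
successors. A vertex of height `k` is recorded by the labels in `ℤ/2` of the edges of the path
that leads to it from the distinguished end `ω`: `label i` is the label of the edge from height
`i` to height `i + 1` (for `i < k`), all but finitely many of them are `0`, and the two edges
from a vertex to its successors have different labels. -/
@[ext] structure TreeVertex where
  height : ℤ
  label : ℤ →₀ ZMod 2
  label_eq_zero : ∀ i, height ≤ i → label i = 0

namespace TreeVertex

/-- The predecessor of a vertex: forget the last label. -/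
def pred (v : TreeVertex) : TreeVertex where
  height := v.height - 1
  label := v.label.erase (v.height - 1)
  label_eq_zero i hi := by
    by_cases h : i = v.height - 1
    · simp [h]
    · rw [Finsupp.erase_ne h]
      exact v.label_eq_zero i (by omega)

theorem height_pred (v : TreeVertex) : v.pred.height = v.height - 1 := rfl

/-- The vertex of height `k` on the line from `ω` all of whose labels are `0`; the base vertex of
the tree is `zero 0`. -/
def zero (k : ℤ) : TreeVertex := ⟨k, 0, fun _ _ => rfl⟩

theorem pred_zero (k : ℤ) : (zero k).pred = zero (k - 1) := by
  ext <;> simp [zero, pred]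

end TreeVertex

/-- The tree: each vertex is joined to its predecessor and to its successors. -/
def tree : SimpleGraph TreeVertex where
  Adj v w := v = w.pred ∨ w = v.pred
  symm := ⟨fun _ _ h => h.symm⟩
  loopless := ⟨fun v h => by
    have h1 : v = v.pred := by tauto
    have h2 := congrArg TreeVertex.height h1
    rw [TreeVertex.height_pred] at h2
    omega⟩

theorem tree_walk_height {v w : TreeVertex} (p : tree.Walk v w) :
    v.height - w.height ≤ p.length := by
  induction p with
  | nil => simp
  | cons h p ih =>
    rw [SimpleGraph.Walk.length_cons]
    push_cast
    rcases h with h | h <;>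
      · have hh := congrArg TreeVertex.height h
        rw [TreeVertex.height_pred] at hh
        omega

theorem tree_walk_down (k : ℤ) (n : ℕ) :
    ∃ p : tree.Walk (TreeVertex.zero k) (TreeVertex.zero (k - n)), p.length = n := by
  induction n with
  | zero => exact ⟨SimpleGraph.Walk.nil.copy rfl (by simp), by simp⟩
  | succ n ih =>
    obtain ⟨p, hp⟩ := ih
    have h : tree.Adj (TreeVertex.zero (k - n)) (TreeVertex.zero (k - (n + 1 : ℕ))) := by
      right
      rw [TreeVertex.pred_zero]
      congr 1
      push_cast
      ring
    exact ⟨p.concat h, by simp [hp]⟩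

/-- The downward ray from the base vertex, which always follows predecessors. -/
def downRay : GeodRay tree :=
  ⟨fun n => TreeVertex.zero (-n), fun m n hmn => by
    have hw := tree_walk_down (-m) (n - m)
    have e : (-(m : ℤ) - ((n - m : ℕ) : ℤ)) = -n := by push_cast [hmn]; ring
    rw [e] at hw
    obtain ⟨p, hp⟩ := hw
    apply le_antisymm
    · have := SimpleGraph.edist_le p
      rwa [hp] at this
    · rw [SimpleGraph.edist_eq_sInf]
      apply le_sInf
      rintro _ ⟨q, rfl⟩
      have key : ∀ q : tree.Walk (TreeVertex.zero (-m)) (TreeVertex.zero (-n)),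
          n - m ≤ q.length := by
        intro q
        have h : (-(m : ℤ)) - (-(n : ℤ)) ≤ q.length := tree_walk_height q
        omega
      change ((n - m : ℕ) : ℕ∞) ≤ (q.length : ℕ∞)
      exact_mod_cast key q⟩

/-- The distinguished end of the tree. The ends of the tree are the points of its visual
boundary. -/
def omegaEnd : VisualBoundary tree := downRay.cls

/-- A path in the tree approaches the end `e` if from some time on it is a geodesic ray that
represents `e`. -/
def ApproachesEnd (x : ℕ → TreeVertex) (e : VisualBoundary tree) : Prop :=
  ∃ (N : ℕ) (ρ : GeodRay tree), ρ.cls = e ∧ ∀ n, x (N + n) = ρ n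

/-! ### The Diestel–Leader graph -/

/-- The vertices of the Diestel–Leader graph `DL₂(2)`: pairs of vertices of two copies `T₀`, `T₁`
of the tree, whose heights add up to zero. -/
@[ext] structure DLVertex where
  x₀ : TreeVertex
  x₁ : TreeVertex
  height_add : x₀.height + x₁.height = 0

/-- The Diestel–Leader graph `DL₂(2)`. -/
def DL : SimpleGraph DLVertex where
  Adj v w := tree.Adj v.x₀ w.x₀ ∧ tree.Adj v.x₁ w.x₁
  symm := ⟨fun _ _ h => ⟨h.1.symm, h.2.symm⟩⟩
  loopless := ⟨fun v h => tree.loopless.irrefl v.x₀ h.1⟩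

/-! ### The lamplighter group -/

/-- An element of the lamplighter group `L₂ = ℤ/2 ≀ ℤ`: a lamp stand, that is, the finitely many
lit lamps (those with value `1`) together with the position of the lamplighter. -/
@[ext] structure L2 where
  lamps : ℤ →₀ ZMod 2
  pos : ℤ

namespace L2

/-- Shift of the lamps by `k` to the right. -/
def shift (k : ℤ) (f : ℤ →₀ ZMod 2) : ℤ →₀ ZMod 2 := f.equivMapDomain (Equiv.addRight k)

@[simp] theorem shift_apply (k : ℤ) (f : ℤ →₀ ZMod 2) (i : ℤ) : shift k f i = f (i - k) := by
  simp [shift, sub_eq_add_neg]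

/-- Composition of lamp stands: `h` is performed from the position of the lamplighter in `g`. -/
instance : Mul L2 := ⟨fun g h => ⟨g.lamps + shift g.pos h.lamps, g.pos + h.pos⟩⟩
instance : One L2 := ⟨⟨0, 0⟩⟩
instance : Inv L2 := ⟨fun g => ⟨- shift (-g.pos) g.lamps, -g.pos⟩⟩

@[simp] theorem mul_lamps (g h : L2) : (g * h).lamps = g.lamps + shift g.pos h.lamps := rfl
@[simp] theorem mul_pos (g h : L2) : (g * h).pos = g.pos + h.pos := rfl
@[simp] theorem one_lamps : (1 : L2).lamps = 0 := rfl
@[simp] theorem one_pos : (1 : L2).pos = 0 := rfl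
@[simp] theorem inv_lamps (g : L2) : g⁻¹.lamps = - shift (-g.pos) g.lamps := rfl
@[simp] theorem inv_pos (g : L2) : g⁻¹.pos = -g.pos := rfl

instance : Group L2 :=
  Group.ofLeftAxioms
    (fun a b c => by
      ext i
      · simp [add_assoc, sub_sub]
      · simp [add_assoc])
    (fun a => by ext i <;> simp)
    (fun a => by ext i <;> simp)

/-- The generator of `ℤ`. -/
def t : L2 := ⟨0, 1⟩

/-- The generator of `ℤ/2`. -/
def a : L2 := ⟨Finsupp.single 0 1, 0⟩

/-- The exponent sum of `t`, as a homomorphism to `ℤ` with `a ↦ 0` and `t ↦ 1`. -/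
def expHom : L2 →* Multiplicative ℤ where
  toFun g := Multiplicative.ofAdd g.pos
  map_one' := rfl
  map_mul' _ _ := rfl

/-- The exponent sum of `t` in a group element. -/
def expT (g : L2) : ℤ := Multiplicative.toAdd (expHom g)

/-- Reflection of the row of lamps, exchanging `j` and `-1 - j`. -/
def reflect (f : ℤ →₀ ZMod 2) : ℤ →₀ ZMod 2 := f.equivMapDomain (Equiv.subLeft (-1))

@[simp] theorem reflect_apply (f : ℤ →₀ ZMod 2) (i : ℤ) : reflect f i = f (-1 - i) := by
  simp only [reflect, Finsupp.equivMapDomain_apply]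
  congr 1
  rw [Equiv.symm_apply_eq]
  simp

/-- The identification of lamp stands with vertices of `DL₂(2)`: the height in `T₀` is the
position `k` of the lamplighter, the labels in `T₀` are the states of the lamps at positions
`< k`, and the labels in `T₁` are those of the lamps at positions `≥ k`, read in the opposite
direction. -/
def vertexEquiv : L2 ≃ DLVertex where
  toFun g :=
    { x₀ := ⟨g.pos, g.lamps.filter (· < g.pos), fun i hi =>
        Finsupp.filter_apply_neg _ _ (not_lt.mpr hi)⟩
      x₁ := ⟨-g.pos, reflect (g.lamps.filter (g.pos ≤ ·)), fun i hi => by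
        rw [reflect_apply]
        exact Finsupp.filter_apply_neg _ _ (by omega)⟩
      height_add := by simp }
  invFun v := ⟨v.x₀.label + reflect v.x₁.label, v.x₀.height⟩
  left_inv g := by
    ext i
    · simp only [Finsupp.add_apply, reflect_apply, Finsupp.filter_apply]
      rw [show (-1 - (-1 - i)) = i by ring]
      by_cases h : i < g.pos
      · simp [h]
      · simp [h, not_lt.mp h]
    · rfl
  right_inv v := by
    have hv := v.height_add
    ext i
    · rfl
    · simp only [Finsupp.add_apply, reflect_apply, Finsupp.filter_apply]
      split_ifs with h
      · rw [v.x₁.label_eq_zero _ (by omega), add_zero]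
      · exact (v.x₀.label_eq_zero _ (by omega)).symm
    · change - v.x₀.height = v.x₁.height
      omega
    · simp only [Finsupp.add_apply, reflect_apply, Finsupp.filter_apply]
      rw [show (-1 - (-1 - i)) = i by ring]
      split_ifs with h
      · rw [v.x₀.label_eq_zero _ h, zero_add]
      · exact (v.x₁.label_eq_zero _ (by omega)).symm

theorem zmod2_cases (x : ZMod 2) : x = 0 ∨ x = 1 := by
  revert x
  decide

theorem up_iff (g h : L2) :
    ((vertexEquiv g).x₀ = (vertexEquiv h).x₀.pred ∧ (vertexEquiv h).x₁ = (vertexEquiv g).x₁.pred)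
      ↔ (h = g * t ∨ h = g * (a * t)) := by
  constructor
  · rintro ⟨h0, h1⟩
    have hp : h.pos = g.pos + 1 := by
      have := congrArg TreeVertex.height h0
      simp [vertexEquiv, TreeVertex.pred] at this
      omega
    have key : ∀ i, i ≠ g.pos → h.lamps i = g.lamps i := by
      intro i hi
      rcases lt_or_gt_of_ne hi with hlt | hgt
      · have := DFunLike.congr_fun (congrArg TreeVertex.label h0) i
        simp only [vertexEquiv, TreeVertex.pred, Equiv.coe_fn_mk, hp] at this
        rw [Finsupp.erase_ne (by omega), Finsupp.filter_apply, Finsupp.filter_apply,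
          if_pos hlt, if_pos (by omega)] at this
        exact this.symm
      · have := DFunLike.congr_fun (congrArg TreeVertex.label h1) (-1 - i)
        simp only [vertexEquiv, TreeVertex.pred, Equiv.coe_fn_mk, hp] at this
        rw [Finsupp.erase_ne (by omega), reflect_apply, reflect_apply,
          show (-1 - (-1 - i)) = i by ring, Finsupp.filter_apply, Finsupp.filter_apply,
          if_pos (by omega), if_pos (by omega)] at this
        exact this
    have hd : h.lamps g.pos = g.lamps g.pos ∨ h.lamps g.pos = g.lamps g.pos + 1 := by
      rcases zmod2_cases (h.lamps g.pos - g.lamps g.pos) with hc | hc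
      · left; exact sub_eq_zero.mp hc
      · right; rw [← hc]; ring
    rcases hd with hd | hd
    · left
      ext i
      · by_cases hi : i = g.pos
        · subst hi; simp [t, hd]
        · simp [t, key i hi]
      · simp [t, hp]
    · right
      ext i
      · by_cases hi : i = g.pos
        · subst hi; simp [t, a, hd]
        · have : (0 : ℤ) ≠ i - g.pos := by omega
          simp [t, a, key i hi, this]
      · simp [t, a, hp]
  · rintro (rfl | rfl)
    · constructor
      · ext i
        · simp [vertexEquiv, TreeVertex.pred, t]
        · by_cases hi : i = g.pos
          · subst hi; simp [vertexEquiv, TreeVertex.pred, t]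
          · have e : i ≤ g.pos ↔ i < g.pos := by omega
            simp [vertexEquiv, TreeVertex.pred, t, Finsupp.erase, Finsupp.filter_apply, hi, e]
      · ext i
        · simp [vertexEquiv, TreeVertex.pred, t]; ring
        · by_cases hi : i = -g.pos - 1
          · subst hi; simp [vertexEquiv, TreeVertex.pred, t, Finsupp.filter_apply]; omega
          · have e : g.pos < -1 - i ↔ g.pos ≤ -1 - i := by omega
            simp [vertexEquiv, TreeVertex.pred, t, Finsupp.erase, Finsupp.filter_apply, hi, e]
    · constructor
      · ext i
        · simp [vertexEquiv, TreeVertex.pred, t, a]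
        · by_cases hi : i = g.pos
          · subst hi; simp [vertexEquiv, TreeVertex.pred, t, a]
          · have e : i ≤ g.pos ↔ i < g.pos := by omega
            have e2 : (0 : ℤ) ≠ i - g.pos := by omega
            simp [vertexEquiv, TreeVertex.pred, t, a, Finsupp.erase, Finsupp.filter_apply, hi, e,
              e2]
      · ext i
        · simp [vertexEquiv, TreeVertex.pred, t, a]; ring
        · by_cases hi : i = -g.pos - 1
          · subst hi
            have e : ¬ g.pos < -1 - (-g.pos - 1) := by omega
            simp [vertexEquiv, TreeVertex.pred, t, a, e]
          · have e : g.pos < -1 - i ↔ g.pos ≤ -1 - i := by omega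
            have e2 : (0 : ℤ) ≠ -1 - i - g.pos := by omega
            simp [vertexEquiv, TreeVertex.pred, t, a, Finsupp.erase, Finsupp.filter_apply, hi, e,
              e2]

/-- `DL₂(2)` is the Cayley graph of `L₂` with respect to the generators `t` and `at`. -/
theorem adj_iff (g h : L2) :
    DL.Adj (vertexEquiv g) (vertexEquiv h) ↔
      (h = g * t ∨ h = g * (a * t)) ∨ (g = h * t ∨ g = h * (a * t)) := by
  rw [← up_iff, ← up_iff]
  have hg := (vertexEquiv g).height_add
  have hh := (vertexEquiv h).height_add
  constructor
  · rintro ⟨h0 | h0, h1 | h1⟩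
    · have e0 := congrArg TreeVertex.height h0
      have e1 := congrArg TreeVertex.height h1
      rw [TreeVertex.height_pred] at e0 e1
      omega
    · exact Or.inl ⟨h0, h1⟩
    · exact Or.inr ⟨h0, h1⟩
    · have e0 := congrArg TreeVertex.height h0
      have e1 := congrArg TreeVertex.height h1
      rw [TreeVertex.height_pred] at e0 e1
      omega
  · rintro (⟨h0, h1⟩ | ⟨h0, h1⟩)
    · exact ⟨Or.inl h0, Or.inr h1⟩
    · exact ⟨Or.inr h0, Or.inl h1⟩

/-- Left multiplication by `g`, as an automorphism of `DL₂(2)`. -/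
def toIso (g : L2) : DL ≃g DL where
  toEquiv := (vertexEquiv.symm.trans (Equiv.mulLeft g)).trans vertexEquiv
  map_rel_iff' := by
    intro v w
    obtain ⟨x, rfl⟩ := vertexEquiv.surjective v
    obtain ⟨y, rfl⟩ := vertexEquiv.surjective w
    simp [adj_iff, mul_assoc]

end L2

/-! ### The boundary of `DL₂(2)` and the action of `L₂` -/

/-- The asymptotic classes of geodesic rays in `DL₂(2)`. -/
abbrev Bdry : Type := VisualBoundary DL

/-- The action of `L₂` on the boundary induced by its action on the Cayley graph. -/
instance : MulAction L2 Bdry where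
  smul g := VisualBoundary.map g.toIso
  one_smul ξ := by
    obtain ⟨γ, rfl⟩ := Quotient.exists_rep ξ
    change GeodRay.cls (GeodRay.map _ γ) = GeodRay.cls γ
    congr 1
    apply Subtype.ext
    funext n
    simp [GeodRay.map, L2.toIso]
  mul_smul g h ξ := by
    obtain ⟨γ, rfl⟩ := Quotient.exists_rep ξ
    change GeodRay.cls (GeodRay.map _ γ) = GeodRay.cls (GeodRay.map _ (GeodRay.map _ γ))
    congr 1
    apply Subtype.ext
    funext n
    simp [GeodRay.map, L2.toIso]

/-- `(∂T₀ − ω₀) × {ω₁}`: the classes of the rays whose projection to `T₀` approaches an end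
other than `ω₀` and whose projection to `T₁` approaches `ω₁`. -/
def bdryPlus : Set Bdry :=
  {ξ | ∃ γ : GeodRay DL, γ.cls = ξ ∧
    (∃ e, e ≠ omegaEnd ∧ ApproachesEnd (fun n => (γ n).x₀) e) ∧
      ApproachesEnd (fun n => (γ n).x₁) omegaEnd}

/-- `(∂T₁ − ω₁) × {ω₀}`: the classes of the rays whose projection to `T₁` approaches an end
other than `ω₁` and whose projection to `T₀` approaches `ω₀`. -/
def bdryMinus : Set Bdry :=
  {ξ | ∃ γ : GeodRay DL, γ.cls = ξ ∧
    (∃ e, e ≠ omegaEnd ∧ ApproachesEnd (fun n => (γ n).x₁) e) ∧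
      ApproachesEnd (fun n => (γ n).x₀) omegaEnd}

/-- The class `ξ` has the lamp stand `f` (a state for every lamp), with the lamplighter at `+∞`
if `l = atTop` and at `-∞` if `l = atBot`. -/
def HasLampStand (ξ : Bdry) (f : ℤ → ZMod 2) (l : Filter ℤ) : Prop :=
  ∃ γ : GeodRay DL, γ.cls = ξ ∧
    (∀ i, ∀ᶠ n in atTop, (L2.vertexEquiv.symm (γ n)).lamps i = f i) ∧
      Tendsto (fun n => (L2.vertexEquiv.symm (γ n)).pos) atTop l

/-- `ξ` is `g^∞`: its lamp stand is the limit of the lamp stands of the powers `g ^ n`. -/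
def IsPowerLimit (g : L2) (ξ : Bdry) : Prop :=
  ∃ f : ℤ → ZMod 2, (∀ i, ∀ᶠ n : ℕ in atTop, (g ^ n).lamps i = f i) ∧
    ((0 < g.expT ∧ HasLampStand ξ f atTop) ∨ (g.expT < 0 ∧ HasLampStand ξ f atBot))

/-- North-south dynamics of `g` on the boundary with the topology `τ`, with attractor `α` and
repeller `ρ`. -/
def NorthSouth (τ : TopologicalSpace Bdry) (g : L2) (α ρ : Bdry) : Prop :=
  α ≠ ρ ∧ g • α = α ∧ g • ρ = ρ ∧
    (∀ ξ, ξ ≠ ρ → Tendsto (fun n : ℕ => g ^ n • ξ) atTop (@nhds Bdry τ α)) ∧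
    (∀ ξ, ξ ≠ α → Tendsto (fun n : ℕ => g⁻¹ ^ n • ξ) atTop (@nhds Bdry τ ρ)) ∧
    ∀ U V : Set Bdry, IsOpen[τ] U → IsOpen[τ] V → α ∈ U → ρ ∈ V →
      ∃ N : ℕ, ∀ n : ℕ, N ≤ n → (∀ ξ, ξ ∉ V → g ^ n • ξ ∈ U) ∧ (∀ ξ, ξ ∉ U → g⁻¹ ^ n • ξ ∈ V)

/-- Attraction in the two halves: the forward orbits of the points of `A` converge to `α ∈ A`,
and the backward orbits of the points of `R` converge to `ρ ∈ R`, in the topology based at any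
vertex. -/
def HalfAttraction (g : L2) (α ρ : Bdry) (A R : Set Bdry) : Prop :=
  α ∈ A ∧ ρ ∈ R ∧ ∀ p : DLVertex,
    (∀ ξ ∈ A, Tendsto (fun n : ℕ => g ^ n • ξ) atTop (@nhds Bdry (VisualBoundary.based DL p) α)) ∧
    (∀ ξ ∈ R, Tendsto (fun n : ℕ => g⁻¹ ^ n • ξ) atTop (@nhds Bdry (VisualBoundary.based DL p) ρ))

/-- `ξ` is represented by a ray from `p` without turns, along which the heights in the two trees
are monotone. -/
def HasTurnlessRay (p : DLVertex) (ξ : Bdry) : Prop :=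
  ∃ γ : GeodRay DL, γ.cls = ξ ∧ γ 0 = p ∧
    ((∀ n, (γ (n + 1)).x₀.height = (γ n).x₀.height + 1) ∨
      (∀ n, (γ (n + 1)).x₀.height = (γ n).x₀.height - 1))

end

/-!
Along a geodesic ray of `DL₂(2)` the lamplighter turns at most once, since a further turn would
cross an interval twice that can be swept with fewer steps. So the lamps converge along the ray,
and a class amounts to a direction in which the lamplighter escapes together with a limit that
vanishes far behind. In the direction in which the lamplighter escapes, `g` acts on the limits by
an affine map over the shift by `±exp_t(g)`. If `exp_t(g) = 0`, this is the translation by the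
lamps of `g`, which is a fixed point free involution. Otherwise both `α = g^∞` and `ρ = g^{-∞}` are
fixed; in the direction of `α` the shift pushes the lamps that differ from those of `α` out to
infinity, and in the opposite direction it pulls the first lamp that differs from those of `ρ` far
behind.

A ray from `p` to a class whose lamps agree with `α` for long shares a long initial segment with
the ray to `α`. A ray from `p` to a class in the opposite direction has to visit the first lamp
that differs from `p` before it turns, so it shares a long initial segment with the ray to `α` if
that ray does not turn, but a short one if it does.
-/

noncomputable section

/-! ### Geodesic rays and their asymptotic classes -/

section Graphs

variable {V : Type*} {G : SimpleGraph V} {v w : V} {n : ℕ}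

theorem exists_walk_length_le_of_edist_le (h : G.edist v w ≤ n) :
    ∃ q : G.Walk v w, q.length ≤ n := by
  obtain ⟨q, hq⟩ := SimpleGraph.exists_walk_of_edist_ne_top
    (ne_top_of_le_ne_top (ENat.natCast_ne_top n) h)
  rw [← hq] at h
  exact ⟨q, by exact_mod_cast h⟩

theorem abs_sub_le_of_edist_le {k : V → ℤ} (hk : ∀ v w, G.Adj v w → |k v - k w| ≤ 1)
    (h : G.edist v w ≤ n) : |k v - k w| ≤ n := by
  obtain ⟨q, hq⟩ := exists_walk_length_le_of_edist_le h
  suffices |k v - k w| ≤ q.length by omega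
  clear h hq
  induction q with
  | nil => simp
  | @cons u v w huv q ih =>
    rw [SimpleGraph.Walk.length_cons, Nat.cast_succ, add_comm]
    exact (abs_sub_le _ (k v) _).trans (add_le_add (hk u v huv) ih)

theorem edist_le_of_forall_adj_succ {x : ℕ → V} (hx : ∀ n, G.Adj (x n) (x (n + 1))) {m n : ℕ}
    (hmn : m ≤ n) : G.edist (x m) (x n) ≤ (n - m : ℕ) := by
  induction n, hmn using Nat.le_induction with
  | base => simp
  | succ n hmn ih =>
    calc G.edist (x m) (x (n + 1)) ≤ G.edist (x m) (x n) + G.edist (x n) (x (n + 1)) :=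
          SimpleGraph.edist_triangle
      _ ≤ (n - m : ℕ) + 1 := add_le_add ih (SimpleGraph.edist_eq_one_iff_adj.2 (hx n)).le
      _ = (n + 1 - m : ℕ) := by norm_cast; omega

namespace GeodRay

/-- The geodesic ray along a path on which the distance of two points is at least the difference
of their parameters. -/
def ofPath (x : ℕ → V) (hx : ∀ n, G.Adj (x n) (x (n + 1)))
    (h : ∀ m n C : ℕ, m ≤ n → G.edist (x m) (x n) ≤ C → n ≤ m + C) : GeodRay G :=
  ⟨x, fun m n hmn => le_antisymm (edist_le_of_forall_adj_succ hx hmn) <|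
    le_iInf fun q => Nat.cast_le.2 <| Nat.sub_le_iff_le_add'.2 <|
      h m n q.length hmn (SimpleGraph.edist_le q)⟩

@[simp] theorem coe_ofPath (x : ℕ → V) (hx : ∀ n, G.Adj (x n) (x (n + 1)))
    (h : ∀ m n C : ℕ, m ≤ n → G.edist (x m) (x n) ≤ C → n ≤ m + C) :
    ⇑(ofPath x hx h) = x := rfl

variable {γ γ' : GeodRay G}

theorem adj (γ : GeodRay G) (n : ℕ) : G.Adj (γ n) (γ (n + 1)) := by
  rw [← SimpleGraph.edist_eq_one_iff_adj, γ.2 n (n + 1) n.le_succ]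
  simp

theorem cls_eq_iff : γ.cls = γ'.cls ↔ ∃ C : ℕ, ∀ n : ℕ, G.edist (γ n) (γ' n) ≤ C :=
  Quotient.eq (r := asymptotic G)

theorem cls_eq_of_eventually_le {C : ℕ} (h : ∀ᶠ n in atTop, G.edist (γ n) (γ' n) ≤ C) :
    γ.cls = γ'.cls := by
  obtain ⟨N, hN⟩ := eventually_atTop.1 h
  refine cls_eq_iff.2 ⟨N + (C + N), fun n => ?_⟩
  rcases le_total N n with hn | hn
  · exact (hN n hn).trans (by norm_cast; omega)
  · calc G.edist (γ n) (γ' n)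
        ≤ G.edist (γ n) (γ N) + (G.edist (γ N) (γ' N) + G.edist (γ' N) (γ' n)) :=
          SimpleGraph.edist_triangle.trans (add_le_add_right SimpleGraph.edist_triangle _)
      _ ≤ (N - n : ℕ) + (C + (N - n : ℕ)) :=
          add_le_add (γ.2 n N hn).le (add_le_add (hN N le_rfl)
            (SimpleGraph.edist_comm.trans (γ'.2 n N hn)).le)
      _ ≤ (N + (C + N) : ℕ) := by norm_cast; omega

end GeodRay

theorem isOpen_induced_pi_bot_iff {X : Type*} {φ : X → ℕ → V} {s : Set X} :
    IsOpen[TopologicalSpace.induced φ (@Pi.topologicalSpace ℕ (fun _ => V) fun _ => ⊥)] s ↔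
      ∀ x ∈ s, ∃ N, ∀ y, (∀ n < N, φ y n = φ x n) → y ∈ s := by
  let _ : TopologicalSpace V := ⊥
  have _ : DiscreteTopology V := ⟨rfl⟩
  let _ : TopologicalSpace X := TopologicalSpace.induced φ Pi.topologicalSpace
  rw [((PiNat.isTopologicalBasis_cylinders fun _ : ℕ => V).induced φ).isOpen_iff]
  refine forall₂_congr fun x _ => ⟨?_, fun ⟨N, hN⟩ => ?_⟩
  · rintro ⟨_, ⟨_, ⟨z, N, rfl⟩, rfl⟩, hx, hs⟩
    exact ⟨N, fun y hy => hs fun n hn => (hy n hn).trans (hx n hn)⟩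
  · exact ⟨_, ⟨_, ⟨φ x, N, rfl⟩, rfl⟩, fun _ _ => rfl, fun y hy => hN y hy⟩

namespace VisualBoundary

theorem isOpen_based_iff {p : V} {U : Set (VisualBoundary G)} :
    IsOpen[based G p] U ↔ ∀ γ : GeodRay G, γ 0 = p → γ.cls ∈ U →
      ∃ N : ℕ, ∀ γ' : GeodRay G, γ' 0 = p → (∀ n < N, γ' n = γ n) → γ'.cls ∈ U := by
  rw [isOpen_coinduced]
  refine (iff_of_eq (congrArg (fun τ => IsOpen[τ] _) (induced_compose ..))).trans <|
    isOpen_induced_pi_bot_iff.trans ?_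
  simp only [Subtype.forall]
  rfl

theorem based_le_unbased (p : V) : based G p ≤ unbased G := fun _ hU =>
  (isOpen_coinduced.1 hU).preimage continuous_subtype_val

end VisualBoundary

end Graphs

/-! ### Taut sequences of integers -/

/-- A path in `ℤ` is taut if between two times it never takes longer than it would to descend to
the minimum of the values it visits meanwhile, to sweep up to their maximum and to descend to its
final value. The positions of the lamplighter along a geodesic have this property. -/
structure IsTaut (k : ℕ → ℤ) : Prop where
  step : ∀ n, k (n + 1) = k n + 1 ∨ k (n + 1) = k n - 1
  length_le : ∀ ⦃i j : ℕ⦄ ⦃lo hi : ℤ⦄, i ≤ j → (∀ m, i ≤ m → m ≤ j → lo ≤ k m ∧ k m ≤ hi) →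
    (j : ℤ) - i ≤ 2 * (hi - lo) - (k j - k i)

/-- A path in `ℤ` that descends for `d` steps and then ascends forever. -/
def IsValley (k : ℕ → ℤ) (d : ℕ) : Prop := ∀ n : ℕ, k n = k 0 + n - 2 * min n d

namespace IsTaut

variable {k : ℕ → ℤ}

theorem abs_sub_le (h : IsTaut k) {m n : ℕ} (hmn : m ≤ n) : |k n - k m| ≤ n - m := by
  induction n, hmn using Nat.le_induction with
  | base => simp
  | succ n hmn ih =>
    rw [abs_le] at ih ⊢
    rcases h.step n with hn | hn <;> constructor <;> push_cast <;> omega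

theorem unbounded (h : IsTaut k) : (∀ B, ∃ n, B < k n) ∨ ∀ B, ∃ n, k n < B := by
  by_contra! hbdd
  obtain ⟨⟨hi, hhi⟩, lo, hlo⟩ := hbdd
  have := h.length_le (Nat.zero_le (3 * (hi - lo) + 1).toNat) fun m _ _ => ⟨hlo m, hhi m⟩
  have := hlo (3 * (hi - lo) + 1).toNat
  have := hhi 0
  omega

theorem exists_first_passage (h : IsTaut k) (hub : ∀ B, ∃ n, B < k n) {i : ℕ} {B : ℤ}
    (hi : k i < B) : ∃ j, i < j ∧ k j = B ∧ ∀ m, i ≤ m → m < j → k m < B := by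
  classical
  have hex : ∃ j, i ≤ j ∧ B ≤ k j := by
    obtain ⟨j, hj⟩ := hub (B + i)
    refine ⟨j, ?_, by omega⟩
    by_contra! hji
    have := abs_le.1 (h.abs_sub_le hji.le)
    omega
  obtain ⟨hij, hB⟩ := Nat.find_spec hex
  have hlt : ∀ m, i ≤ m → m < Nat.find hex → k m < B :=
    fun m hm hmj => not_le.1 fun hBm => Nat.find_min hex hmj ⟨hm, hBm⟩
  have hne : i ≠ Nat.find hex := fun he => by rw [← he] at hB; omega
  obtain ⟨m, hm⟩ := Nat.exists_eq_add_one_of_ne_zero (by omega : Nat.find hex ≠ 0)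
  refine ⟨Nat.find hex, by omega, hB.antisymm' ?_, hlt⟩
  have := hlt m (by omega) (by omega)
  rcases h.step m with hs | hs <;> rw [hm, hs] <;> omega

theorem ascends_succ (h : IsTaut k) (hub : ∀ B, ∃ n, B < k n) {i : ℕ} (hi : k (i + 1) = k i + 1) :
    k (i + 2) = k (i + 1) + 1 := by
  obtain ⟨j, hij, hj, hlt⟩ := h.exists_first_passage hub (by omega : k i < k i + 2)
  obtain ⟨m, hm, hmin⟩ :=
    Finset.exists_min_image (Finset.Icc i j) k ⟨i, Finset.left_mem_Icc.2 hij.le⟩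
  simp only [Finset.mem_Icc] at hm hmin
  have hlen := h.length_le hij.le fun l hil hlj =>
    ⟨hmin l ⟨hil, hlj⟩, hlj.eq_or_lt.elim (fun e => e ▸ hj.le) fun hl => (hlt l hil hl).le⟩
  -- A dip below `k i` would be crossed twice, and then sweeping the visited interval is faster.
  have hmi : m = i := by
    by_contra hne
    have hdown := abs_le.1 (h.abs_sub_le (by omega : i + 1 ≤ m))
    have hup := abs_le.1 (h.abs_sub_le hm.2)
    push_cast at hdown
    omega
  subst hmi
  have : j ≠ m + 1 := fun e => by subst e; omega
  obtain rfl : j = m + 2 := by omega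
  omega

theorem exists_isValley (h : IsTaut k) (hub : ∀ B, ∃ n, B < k n) : ∃ d, IsValley k d := by
  classical
  have hex : ∃ d, k (d + 1) = k d + 1 := by
    by_contra! hdown
    have hle (n : ℕ) : k n ≤ k 0 := by
      induction n with
      | zero => rfl
      | succ n ih => have := (h.step n).resolve_left (hdown n); omega
    obtain ⟨n, hn⟩ := hub (k 0)
    exact (hle n).not_gt hn
  have ascends : ∀ n, Nat.find hex ≤ n → k (n + 1) = k n + 1 :=
    fun n hn => Nat.le_induction (Nat.find_spec hex) (fun _ _ => h.ascends_succ hub) n hn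
  refine ⟨Nat.find hex, fun n => ?_⟩
  induction n with
  | zero => simp
  | succ n ih =>
    rcases lt_or_ge n (Nat.find hex) with hn | hn
    · have := (h.step n).resolve_left (Nat.find_min hex hn)
      push_cast
      omega
    · have := ascends n hn
      push_cast
      omega

end IsTaut

/-! ### Lamp stands read in either direction -/

section Overwrite

variable {α M : Type*} [DecidableEq α] [Zero M]

/-- The finitely supported function that agrees with `g` on `I` and with `f` elsewhere. -/
def overwrite (f : α →₀ M) (I : Finset α) (g : α → M) : α →₀ M :=
  Finsupp.onFinset (f.support ∪ I) (fun i => if i ∈ I then g i else f i) fun i hi => by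
    rw [Finset.mem_union, Finsupp.mem_support_iff]
    by_contra! h
    simp [h] at hi

@[simp] theorem overwrite_apply (f : α →₀ M) (I : Finset α) (g : α → M) (i : α) :
    overwrite f I g i = if i ∈ I then g i else f i := rfl

end Overwrite

theorem eventually_cofinite_eq_zero {α M : Type*} [Zero M] (f : α →₀ M) :
    ∀ᶠ i in cofinite, f i = 0 :=
  f.hasFiniteSupport

namespace L2

/-- `h` is obtained from `g` by moving one step to the right, with an arbitrary new state of the
lamp that is passed. -/
def UpStep (g h : L2) : Prop := h.pos = g.pos + 1 ∧ ∀ i, i ≠ g.pos → h.lamps i = g.lamps i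

theorem upStep_iff {g h : L2} : UpStep g h ↔ h = g * t ∨ h = g * (a * t) := by
  constructor
  · rintro ⟨hp, hl⟩
    rcases zmod2_cases (h.lamps g.pos - g.lamps g.pos) with hd | hd
    · refine Or.inl (L2.ext (Finsupp.ext fun i => ?_) hp)
      rcases eq_or_ne i g.pos with rfl | hi
      · simp [t, sub_eq_zero.1 hd]
      · simp [t, hl i hi]
    · refine Or.inr (L2.ext (Finsupp.ext fun i => ?_) (by simp [a, t, hp]))
      rcases eq_or_ne i g.pos with rfl | hi
      · simp [a, t, sub_eq_iff_eq_add'.1 hd]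
      · simp [a, t, hl i hi, Finsupp.single_eq_of_ne (sub_ne_zero.2 hi)]
  · rintro (rfl | rfl)
    · exact ⟨rfl, fun i _ => by simp [t]⟩
    · exact ⟨by simp [a, t],
        fun i hi => by simp [a, t, Finsupp.single_eq_of_ne (sub_ne_zero.2 hi)]⟩

/-- The automorphism of the lamplighter group that reflects the row of lamps. -/
def mirror : L2 ≃* L2 where
  toFun g := ⟨reflect g.lamps, -g.pos⟩
  invFun g := ⟨reflect g.lamps, -g.pos⟩
  left_inv g := by ext i <;> simp
  right_inv g := by ext i <;> simp
  map_mul' g h := by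
    ext i
    · simp [show -1 - i - g.pos = -1 - (i - -g.pos) by ring]
    · simp [add_comm]

@[simp] theorem mirror_pos (g : L2) : (mirror g).pos = -g.pos := rfl

@[simp] theorem mirror_lamps (g : L2) (i : ℤ) : (mirror g).lamps i = g.lamps (-1 - i) :=
  reflect_apply _ _

@[simp] theorem mirror_mirror (g : L2) : mirror (mirror g) = g := mirror.left_inv g

theorem UpStep.mirror {g h : L2} (H : UpStep g h) : UpStep (L2.mirror h) (L2.mirror g) := by
  have hp := H.1
  exact ⟨by simp [hp], fun i hi => by
    rw [mirror_pos] at hi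
    simp [H.2 (-1 - i) (by omega)]⟩

theorem upStep_mirror_iff {g h : L2} : UpStep (mirror g) (mirror h) ↔ UpStep h g :=
  ⟨fun H => by simpa using H.mirror, UpStep.mirror⟩

end L2

/-- The two directions in which the row of lamps can be read. The halves `∂₊` and `∂₋` of the
boundary consist of the classes of the rays along which the lamplighter goes to `+∞` as seen in the
direction `right`, respectively in the direction `left`. -/
inductive Direction
  | right
  | left

namespace Direction

open L2

/-- The opposite direction. -/
def opp : Direction → Direction
  | right => left
  | left => right

@[simp] theorem opp_opp (s : Direction) : s.opp.opp = s := by cases s <;> rfl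

/-- The automorphism of the lamplighter group that translates into the view from `s`. -/
def aut : Direction → L2 ≃* L2
  | right => MulEquiv.refl L2
  | left => mirror

theorem aut_opp (s : Direction) (g : L2) : s.opp.aut g = mirror (s.aut g) := by
  cases s
  · rfl
  · exact (mirror_mirror g).symm

variable (s : Direction)

/-- The lamp stand of a vertex, seen in the direction `s`. -/
def coord : DLVertex ≃ L2 := vertexEquiv.symm.trans s.aut.toEquiv

theorem coord_opp (v : DLVertex) : s.opp.coord v = mirror (s.coord v) := s.aut_opp _

theorem coord_toIso (g : L2) (v : DLVertex) : s.coord (g.toIso v) = s.aut g * s.coord v := by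
  simp [coord, toIso]

/-- The position of the lamplighter, seen in the direction `s`. -/
def pos (v : DLVertex) : ℤ := (s.coord v).pos

/-- The states of the lamps, seen in the direction `s`. -/
def lamp (v : DLVertex) : ℤ →₀ ZMod 2 := (s.coord v).lamps

@[simp] theorem opp_pos (v : DLVertex) : s.opp.pos v = -s.pos v := by
  simp [pos, coord_opp]

@[simp] theorem opp_lamp (v : DLVertex) (i : ℤ) : s.opp.lamp v i = s.lamp v (-1 - i) := by
  simp [lamp, coord_opp]

/-- The vertex with the lamps `f` and the lamplighter at `k`, as seen in the direction `s`. -/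
def vertex (f : ℤ →₀ ZMod 2) (k : ℤ) : DLVertex := s.coord.symm ⟨f, k⟩

@[simp] theorem pos_vertex (f : ℤ →₀ ZMod 2) (k : ℤ) : s.pos (s.vertex f k) = k := by
  simp [pos, vertex]

@[simp] theorem lamp_vertex (f : ℤ →₀ ZMod 2) (k : ℤ) : s.lamp (s.vertex f k) = f := by
  simp [lamp, vertex]

variable {s} {v w : DLVertex}

theorem vertex_ext (hp : s.pos v = s.pos w) (hl : ∀ i, s.lamp v i = s.lamp w i) : v = w :=
  s.coord.injective (L2.ext (Finsupp.ext hl) hp)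

variable (s) in
theorem adj_iff : DL.Adj v w ↔
    UpStep (s.coord v) (s.coord w) ∨ UpStep (s.coord w) (s.coord v) := by
  obtain ⟨g, rfl⟩ := vertexEquiv.surjective v
  obtain ⟨h, rfl⟩ := vertexEquiv.surjective w
  rw [L2.adj_iff, ← upStep_iff, ← upStep_iff]
  cases s
  · simp [coord, aut]
  · simp [coord, aut, upStep_mirror_iff, or_comm]

theorem adj_of_pos_add_one (hp : s.pos w = s.pos v + 1)
    (hl : ∀ i, i ≠ s.pos v → s.lamp w i = s.lamp v i) : DL.Adj v w :=
  s.adj_iff.2 (Or.inl ⟨hp, hl⟩)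

variable (s) in
theorem pos_of_adj (h : DL.Adj v w) : s.pos w = s.pos v + 1 ∨ s.pos w = s.pos v - 1 :=
  (s.adj_iff.1 h).imp (·.1) fun h => eq_sub_of_add_eq h.1.symm

theorem lamp_of_adj (h : DL.Adj v w) {i : ℤ} (hi : i ≠ min (s.pos v) (s.pos w)) :
    s.lamp w i = s.lamp v i := by
  unfold pos at hi
  rcases s.adj_iff.1 h with h | h
  · exact h.2 i (by have := h.1; omega)
  · exact (h.2 i (by have := h.1; omega)).symm

/-! ### Distances -/

variable {n : ℕ}

variable (s) in
theorem abs_pos_sub_le (h : DL.edist v w ≤ n) : |s.pos v - s.pos w| ≤ n :=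
  abs_sub_le_of_edist_le
    (fun v w hvw => by rcases s.pos_of_adj hvw with h | h <;> rw [h] <;> simp) h

/-- A walk between vertices with different lamps at `m` has to pass by `m`. -/
theorem pos_add_pos_sub_le (h : DL.edist v w ≤ n) {m : ℤ} (hm : s.lamp v m ≠ s.lamp w m) :
    s.pos v + s.pos w - 2 * m ≤ n := by
  obtain ⟨q, hq⟩ := exists_walk_length_le_of_edist_le h
  suffices s.pos v + s.pos w - 2 * m ≤ q.length by omega
  clear h hq
  induction q with
  | nil => exact absurd rfl hm
  | @cons u v w huv q ih =>
    rw [SimpleGraph.Walk.length_cons]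
    have hpos := s.pos_of_adj huv
    by_cases hv : s.lamp v m = s.lamp w m
    · have hpass : m = min (s.pos u) (s.pos v) :=
        by_contra fun hne => hm ((lamp_of_adj huv hne).symm.trans hv)
      have := abs_le.1 (s.abs_pos_sub_le (SimpleGraph.edist_le q))
      push_cast
      omega
    · have := ih hv
      push_cast
      omega

/-- On the way up, the lamplighter can change all lamps that are passed. -/
theorem edist_le_of_sweep (hp : s.pos w = s.pos v + n)
    (hl : ∀ i, i < s.pos v ∨ s.pos w ≤ i → s.lamp v i = s.lamp w i) : DL.edist v w ≤ n := by
  induction n generalizing v with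
  | zero =>
    have : v = w := vertex_ext (by simpa using hp.symm) fun i => hl i (by omega)
    simp [this]
  | succ n ih =>
    let u := s.vertex (overwrite (s.lamp v) {s.pos v} (s.lamp w)) (s.pos v + 1)
    have hvu : DL.Adj v u :=
      adj_of_pos_add_one (s := s) (by simp [u]) fun i hi => by simp [u, hi]
    have huw : DL.edist u w ≤ n := by
      refine ih (by simp [u, hp]; ring) fun i hi => ?_
      rcases eq_or_ne i (s.pos v) with rfl | hne
      · simp [u]
      · rw [pos_vertex] at hi
        simpa [u, hne] using hl i (by omega)
    calc DL.edist v w ≤ DL.edist v u + DL.edist u w := SimpleGraph.edist_triangle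
      _ ≤ 1 + n := add_le_add (SimpleGraph.edist_eq_one_iff_adj.2 hvu).le huw
      _ = (n + 1 : ℕ) := by push_cast; rw [add_comm]

/-- Descend to `lo`, sweep up to `hi`, and descend to the final position. -/
theorem edist_le_of_window {lo hi : ℤ} (hv : lo ≤ s.pos v ∧ s.pos v ≤ hi)
    (hw : lo ≤ s.pos w ∧ s.pos w ≤ hi) (hl : ∀ i, i < lo ∨ hi ≤ i → s.lamp v i = s.lamp w i)
    (hn : n = 2 * (hi - lo) - (s.pos w - s.pos v)) : DL.edist v w ≤ n := by
  let x := s.vertex (s.lamp v) lo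
  let y := s.vertex (s.lamp w) hi
  have hvx : DL.edist v x ≤ ((s.pos v - lo).toNat : ℕ) := by
    rw [SimpleGraph.edist_comm]
    exact edist_le_of_sweep (s := s) (by simp [x]; omega) fun i _ => by simp [x]
  have hxy : DL.edist x y ≤ ((hi - lo).toNat : ℕ) :=
    edist_le_of_sweep (s := s) (by simp [x, y]; omega) fun i h => by
      simp only [x, y, pos_vertex, lamp_vertex] at h ⊢
      exact hl i h
  have hyw : DL.edist y w ≤ ((hi - s.pos w).toNat : ℕ) := by
    rw [SimpleGraph.edist_comm]
    exact edist_le_of_sweep (s := s) (by simp [y]; omega) fun i _ => by simp [y]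
  calc DL.edist v w ≤ DL.edist v x + (DL.edist x y + DL.edist y w) :=
        SimpleGraph.edist_triangle.trans (add_le_add_right SimpleGraph.edist_triangle _)
    _ ≤ (s.pos v - lo).toNat + ((hi - lo).toNat + (hi - s.pos w).toNat) :=
        add_le_add hvx (add_le_add hxy hyw)
    _ = n := by norm_cast; omega

end Direction

/-! ### Limits of rays -/

namespace Direction

variable {s : Direction}

theorem lamp_eq_of_ne_min {x : ℕ → DLVertex} (hx : ∀ n, DL.Adj (x n) (x (n + 1))) {m n : ℕ}
    (hmn : m ≤ n) {i : ℤ}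
    (hi : ∀ l, m ≤ l → l < n → i ≠ min (s.pos (x l)) (s.pos (x (l + 1)))) :
    s.lamp (x n) i = s.lamp (x m) i := by
  induction n, hmn using Nat.le_induction with
  | base => rfl
  | succ n hmn ih =>
    exact (lamp_of_adj (hx n) (hi n hmn n.lt_succ_self)).trans
      (ih fun l hml hln => hi l hml (by omega))

variable (s) in
theorem isTaut_pos (γ : GeodRay DL) : IsTaut fun n => s.pos (γ n) where
  step n := s.pos_of_adj (γ.adj n)
  length_le i j lo hi hij hwin := by
    have hi' := hwin i le_rfl hij
    have hj' := hwin j hij le_rfl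
    have hle : DL.edist (γ i) (γ j) ≤ (2 * (hi - lo) - (s.pos (γ j) - s.pos (γ i))).toNat := by
      refine edist_le_of_window hi' hj' (fun m hm => ?_) (Int.toNat_of_nonneg (by omega))
      refine (lamp_eq_of_ne_min γ.adj hij fun l hil hlj => ?_).symm
      have := hwin l hil hlj.le
      have := hwin (l + 1) (by omega) hlj
      have := s.pos_of_adj (γ.adj l)
      omega
    rw [γ.2 i j hij, Nat.cast_le] at hle
    omega

variable (s) in
/-- Along the ray `γ` the lamplighter goes down for `d` steps and then up, as seen in the
direction `s`. -/
def TurnsAt (γ : GeodRay DL) (d : ℕ) : Prop := IsValley (fun n => s.pos (γ n)) d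

variable (s) in
/-- Along the ray `γ` the lamplighter goes to `+∞`, as seen in the direction `s`, and the lamp
stands converge to `f`. -/
def Escapes (γ : GeodRay DL) (f : ℤ → ZMod 2) : Prop :=
  (∀ i, ∀ᶠ n in atTop, s.lamp (γ n) i = f i) ∧ Tendsto (fun n => s.pos (γ n)) atTop atTop

variable (s) in
/-- The lamp stand of the class `ξ` has the lamps `f`, and the lamplighter at `+∞`, as seen in the
direction `s`. -/
def HasLimit (ξ : Bdry) (f : ℤ → ZMod 2) : Prop := ∃ γ : GeodRay DL, γ.cls = ξ ∧ s.Escapes γ f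

variable {γ γ' : GeodRay DL} {f f' : ℤ → ZMod 2} {d : ℕ}

variable (s) in
theorem exists_turnsAt (γ : GeodRay DL) : (∃ d, s.TurnsAt γ d) ∨ ∃ d, s.opp.TurnsAt γ d :=
  (s.isTaut_pos γ).unbounded.imp (s.isTaut_pos γ).exists_isValley fun h =>
    (s.opp.isTaut_pos γ).exists_isValley fun B => by
      obtain ⟨n, hn⟩ := h (-B)
      exact ⟨n, by rw [opp_pos]; omega⟩

namespace TurnsAt

theorem pos_eq (hγ : s.TurnsAt γ d) (n : ℕ) : s.pos (γ n) = s.pos (γ 0) + n - 2 * min n d := hγ n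

theorem tendsto_pos (hγ : s.TurnsAt γ d) : Tendsto (fun n => s.pos (γ n)) atTop atTop :=
  tendsto_atTop.2 fun b => by
    filter_upwards [eventually_ge_atTop (b - s.pos (γ 0) + 2 * d).toNat] with n hn
    have := hγ.pos_eq n
    omega

theorem lamp_eq (hγ : s.TurnsAt γ d) {m n : ℕ} (hm : d ≤ m) (hmn : m ≤ n) {i : ℤ}
    (hi : i < s.pos (γ m)) : s.lamp (γ n) i = s.lamp (γ m) i :=
  lamp_eq_of_ne_min γ.adj hmn fun l hml _ => by
    have := hγ.pos_eq m
    have := hγ.pos_eq l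
    have := hγ.pos_eq (l + 1)
    omega

theorem lamp_eq_start (hγ : s.TurnsAt γ d) (n : ℕ) {i : ℤ}
    (hi : i < s.pos (γ 0) - d ∨ s.pos (γ 0) ≤ i ∧ s.pos (γ n) ≤ i) :
    s.lamp (γ n) i = s.lamp (γ 0) i :=
  lamp_eq_of_ne_min γ.adj n.zero_le fun l _ hln => by
    have := hγ.pos_eq n
    have := hγ.pos_eq l
    have := hγ.pos_eq (l + 1)
    omega

theorem exists_escapes (hγ : s.TurnsAt γ d) : ∃ f, s.Escapes γ f := by
  have hconst (i : ℤ) : ∃ c, ∀ᶠ n in atTop, s.lamp (γ n) i = c := by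
    obtain ⟨m, hm, hi⟩ :=
      ((eventually_ge_atTop d).and (hγ.tendsto_pos.eventually_gt_atTop i)).exists
    exact ⟨_, (eventually_ge_atTop m).mono fun n hmn => hγ.lamp_eq hm hmn hi⟩
  choose f hf using hconst
  exact ⟨f, hf, hγ.tendsto_pos⟩

theorem lamp_eq_limit (hγ : s.TurnsAt γ d) (hf : s.Escapes γ f) {m : ℕ} (hm : d ≤ m) {i : ℤ}
    (hi : i < s.pos (γ m)) : s.lamp (γ m) i = f i := by
  obtain ⟨n, hn, hmn⟩ := ((hf.1 i).and (eventually_ge_atTop m)).exists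
  rw [← hn, hγ.lamp_eq hm hmn hi]

theorem start_eq_limit (hγ : s.TurnsAt γ d) (hf : s.Escapes γ f) {i : ℤ}
    (hi : i < s.pos (γ 0) - d) : s.lamp (γ 0) i = f i := by
  obtain ⟨n, hn⟩ := (hf.1 i).exists
  rw [← hn, hγ.lamp_eq_start n (Or.inl hi)]

end TurnsAt

namespace Escapes

theorem not_opp (hf : s.Escapes γ f) : ¬s.opp.Escapes γ f' := fun hf' => by
  obtain ⟨n, hn, hn'⟩ := ((hf.2.eventually_gt_atTop 0).and (hf'.2.eventually_gt_atTop 0)).exists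
  rw [opp_pos] at hn'
  omega

theorem exists_turnsAt (hf : s.Escapes γ f) : ∃ d, s.TurnsAt γ d :=
  (s.exists_turnsAt γ).resolve_right fun ⟨_, hd⟩ =>
    let ⟨_, hf'⟩ := hd.exists_escapes
    hf.not_opp hf'

theorem eventually_eq_zero (hf : s.Escapes γ f) : ∀ᶠ i in atBot, f i = 0 := by
  obtain ⟨d, hd⟩ := hf.exists_turnsAt
  filter_upwards [(eventually_cofinite_eq_zero (s.lamp (γ 0))).filter_mono atBot_le_cofinite,
    eventually_lt_atBot (s.pos (γ 0) - d)] with i hi hlt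
  rw [← hd.start_eq_limit hf hlt, hi]

/-- A lamp differs along two asymptotic rays only as long as the lamplighter is near it. -/
theorem of_cls_eq (hf : s.Escapes γ f) (h : γ.cls = γ'.cls) : s.Escapes γ' f := by
  obtain ⟨C, hC⟩ := GeodRay.cls_eq_iff.1 h
  have hpos (n : ℕ) := abs_le.1 (s.abs_pos_sub_le (hC n))
  refine ⟨fun i => ?_, tendsto_atTop.2 fun b => ?_⟩
  · filter_upwards [hf.1 i, hf.2.eventually_gt_atTop (C + i)] with n hn hlarge
    rw [← hn]
    by_contra hne
    have := pos_add_pos_sub_le (hC n) (Ne.symm hne)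
    have := hpos n
    omega
  · filter_upwards [hf.2.eventually_ge_atTop (b + C)] with n hn
    have := hpos n
    omega

theorem cls_eq (hf : s.Escapes γ f) (hf' : s.Escapes γ' f) : γ.cls = γ'.cls := by
  obtain ⟨d, hd⟩ := hf.exists_turnsAt
  obtain ⟨d', hd'⟩ := hf'.exists_turnsAt
  wlog hle : s.pos (γ 0) - 2 * d ≤ s.pos (γ' 0) - 2 * d' generalizing γ γ' d d'
  · exact (this hf' hf d' hd' d hd (by omega)).symm
  have hahead : ∀ᶠ i in atTop, s.lamp (γ 0) i = 0 ∧ s.lamp (γ' 0) i = 0 :=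
    ((eventually_cofinite_eq_zero _).and (eventually_cofinite_eq_zero _)).filter_mono
      atTop_le_cofinite
  obtain ⟨B, hB⟩ := eventually_atTop.1 hahead
  refine GeodRay.cls_eq_of_eventually_le
    (C := (s.pos (γ' 0) - 2 * d' - (s.pos (γ 0) - 2 * d)).toNat) ?_
  filter_upwards [eventually_ge_atTop d, eventually_ge_atTop d',
    hf.2.eventually_ge_atTop (max B (max (s.pos (γ 0)) (s.pos (γ' 0))))] with n hn hn' hpos
  have hγ := hd.pos_eq n
  have hγ' := hd'.pos_eq n
  refine edist_le_of_sweep (s := s) (by omega) fun i hi => ?_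
  rcases hi with hi | hi
  · rw [hd.lamp_eq_limit hf hn hi, hd'.lamp_eq_limit hf' hn' (by omega)]
  · rw [hd.lamp_eq_start n (Or.inr (by omega)), hd'.lamp_eq_start n (Or.inr (by omega)),
      (hB i (by omega)).1, (hB i (by omega)).2]

end Escapes

variable {ξ ξ' : Bdry}

namespace HasLimit

theorem escapes (h : s.HasLimit ξ f) (hγ : γ.cls = ξ) : s.Escapes γ f := by
  obtain ⟨γ', rfl, hf⟩ := h
  exact hf.of_cls_eq hγ.symm

theorem not_opp (h : s.HasLimit ξ f) : ¬s.opp.HasLimit ξ f' := fun ⟨_, hγ, hf'⟩ =>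
  (h.escapes hγ).not_opp hf'

theorem limit_unique (h : s.HasLimit ξ f) (h' : s.HasLimit ξ f') : f = f' := by
  obtain ⟨γ, hγ, hf⟩ := h
  funext i
  obtain ⟨n, hn, hn'⟩ := ((hf.1 i).and ((h'.escapes hγ).1 i)).exists
  rw [← hn, hn']

theorem unique (h : s.HasLimit ξ f) (h' : s.HasLimit ξ' f) : ξ = ξ' := by
  obtain ⟨γ, rfl, hf⟩ := h
  obtain ⟨γ', rfl, hf'⟩ := h'
  exact hf.cls_eq hf'

theorem eventually_eq_zero (h : s.HasLimit ξ f) : ∀ᶠ i in atBot, f i = 0 := by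
  obtain ⟨γ, -, hf⟩ := h
  exact hf.eventually_eq_zero

end HasLimit

variable (s) in
theorem exists_hasLimit (ξ : Bdry) : (∃ f, s.HasLimit ξ f) ∨ ∃ f, s.opp.HasLimit ξ f := by
  obtain ⟨γ, rfl⟩ := Quotient.exists_rep ξ
  exact (s.exists_turnsAt γ).imp
    (fun ⟨_, hd⟩ => hd.exists_escapes.imp fun _ hf => ⟨γ, rfl, hf⟩)
    (fun ⟨_, hd⟩ => hd.exists_escapes.imp fun _ hf => ⟨γ, rfl, hf⟩)

end Direction

/-! ### Rays with prescribed limits -/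

namespace Direction

variable {s : Direction}

variable (s) in
/-- The path that goes down `d` steps from `p`, leaving behind the lamps of `e`, and then goes up
forever, leaving behind the lamps of `f`, as seen in the direction `s`. -/
def bentPath (p : DLVertex) (d : ℕ) (e f : ℤ → ZMod 2) (n : ℕ) : DLVertex :=
  s.vertex (overwrite (overwrite (s.lamp p) (Finset.Ico (s.pos p - min n d) (s.pos p)) e)
    (Finset.Ico (s.pos p - d) (s.pos p - 2 * d + n)) f) (s.pos p + n - 2 * min n d)

section BentPath

variable {p : DLVertex} {d : ℕ} {e f f' : ℤ → ZMod 2}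

theorem pos_bentPath (n : ℕ) : s.pos (s.bentPath p d e f n) = s.pos p + n - 2 * min n d :=
  pos_vertex ..

theorem lamp_bentPath (n : ℕ) (i : ℤ) : s.lamp (s.bentPath p d e f n) i =
    if s.pos p - d ≤ i ∧ i < s.pos p - 2 * d + n then f i
    else if s.pos p - min n d ≤ i ∧ i < s.pos p then e i else s.lamp p i := by
  simp [bentPath]

@[simp] theorem bentPath_zero : s.bentPath p d e f 0 = p :=
  vertex_ext (s := s) (by simp [pos_bentPath]) fun i => by
    rw [lamp_bentPath, if_neg (by omega), if_neg (by omega)]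

theorem adj_bentPath (n : ℕ) : DL.Adj (s.bentPath p d e f n) (s.bentPath p d e f (n + 1)) := by
  have hpos := pos_bentPath (s := s) (p := p) (d := d) (e := e) (f := f)
  rcases lt_or_ge n d with hn | hn
  · refine (adj_of_pos_add_one (s := s) (by rw [hpos, hpos]; omega) fun i hi => ?_).symm
    rw [hpos] at hi
    rw [lamp_bentPath, lamp_bentPath]
    exact if_congr (by omega) rfl (if_congr (by omega) rfl rfl)
  · refine adj_of_pos_add_one (s := s) (by rw [hpos, hpos]; omega) fun i hi => ?_
    rw [hpos] at hi
    rw [lamp_bentPath, lamp_bentPath]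
    exact if_congr (by omega) rfl (if_congr (by omega) rfl rfl)

theorem le_add_of_edist_bentPath_le (hd : 0 < d → f (s.pos p - d) ≠ s.lamp p (s.pos p - d))
    {m n C : ℕ} (h : DL.edist (s.bentPath p d e f m) (s.bentPath p d e f n) ≤ C) :
    n ≤ m + C := by
  have hpos := abs_le.1 (s.abs_pos_sub_le h)
  rw [pos_bentPath, pos_bentPath] at hpos
  by_cases hturn : m < d ∧ d < n
  · have := pos_add_pos_sub_le (s := s) h (m := s.pos p - d) (by
      rw [lamp_bentPath, lamp_bentPath, if_neg (by omega), if_neg (by omega), if_pos (by omega)]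
      exact (hd (by omega)).symm)
    rw [pos_bentPath, pos_bentPath] at this
    omega
  · omega

variable (s) in
/-- The path with one turn as a geodesic ray; it is geodesic if the lamp at the turn is changed. -/
def bentRay (p : DLVertex) (d : ℕ) (e f : ℤ → ZMod 2)
    (hd : 0 < d → f (s.pos p - d) ≠ s.lamp p (s.pos p - d)) : GeodRay DL :=
  GeodRay.ofPath (s.bentPath p d e f) adj_bentPath fun _ _ _ _ => le_add_of_edist_bentPath_le hd

theorem escapes_bentRay (hd : 0 < d → f (s.pos p - d) ≠ s.lamp p (s.pos p - d))
    (hf : ∀ i < s.pos p - d, f i = s.lamp p i) : s.Escapes (s.bentRay p d e f hd) f := by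
  have hturn : s.TurnsAt (s.bentRay p d e f hd) d := fun n => by
    simpa only [bentRay, GeodRay.coe_ofPath, bentPath_zero] using pos_bentPath n
  refine ⟨fun i => ?_, hturn.tendsto_pos⟩
  filter_upwards [eventually_gt_atTop (i - s.pos p + 2 * d).toNat] with n hn
  rw [bentRay, GeodRay.coe_ofPath, lamp_bentPath]
  by_cases hi : i < s.pos p - d
  · rw [if_neg (by omega), if_neg (by omega), hf i hi]
  · rw [if_pos (by omega)]

theorem bentPath_congr {n : ℕ} (h : ∀ i < s.pos p - 2 * d + n, f i = f' i) :
    s.bentPath p d e f n = s.bentPath p d e f' n :=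
  vertex_ext (s := s) (by rw [pos_bentPath, pos_bentPath]) fun i => by
    rw [lamp_bentPath, lamp_bentPath]
    split_ifs with hi
    · exact h i hi.2
    all_goals rfl

theorem bentPath_opp_of_le {n : ℕ} (hn : n ≤ d) :
    s.opp.bentPath p d (fun i => f (-1 - i)) f' n = s.bentPath p 0 e f n :=
  vertex_ext (s := s.opp) (by simp [pos_bentPath, hn]; omega) fun i => by
    rw [lamp_bentPath, if_neg (by omega), s.opp_lamp (s.bentPath p 0 e f n), lamp_bentPath,
      opp_pos, opp_lamp]
    exact (if_congr (by omega) rfl (by rw [if_neg (by omega)]))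

theorem exists_depth (p : DLVertex) (hf : ∀ᶠ i in atBot, f i = 0) :
    ∃ d : ℕ, (∀ i < s.pos p - d, f i = s.lamp p i) ∧
      (0 < d → f (s.pos p - d) ≠ s.lamp p (s.pos p - d)) := by
  classical
  have hex : ∃ d : ℕ, ∀ i < s.pos p - d, f i = s.lamp p i := by
    obtain ⟨B, hB⟩ := eventually_atBot.1
      (hf.and ((eventually_cofinite_eq_zero (s.lamp p)).filter_mono atBot_le_cofinite))
    exact ⟨(s.pos p - B).toNat, fun i hi => by rw [(hB i (by omega)).1, (hB i (by omega)).2]⟩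
  refine ⟨Nat.find hex, Nat.find_spec hex, fun hd heq => ?_⟩
  refine Nat.find_min hex (Nat.pred_lt_self hd) fun i hi => ?_
  rcases eq_or_ne i (s.pos p - Nat.find hex) with rfl | hne
  · exact heq
  · exact Nat.find_spec hex i (by rw [Nat.pred_eq_sub_one] at hi; omega)

end BentPath

variable {f : ℤ → ZMod 2} {ξ : Bdry} {p : DLVertex}

variable (s) in
theorem exists_hasLimit_of_eventually_eq_zero (hf : ∀ᶠ i in atBot, f i = 0) :
    ∃ ξ, s.HasLimit ξ f := by
  obtain ⟨d, hlt, hd⟩ := exists_depth (s := s) (s.vertex 0 0) hf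
  exact ⟨_, s.bentRay _ d 0 f hd, rfl, escapes_bentRay hd hlt⟩

variable (s) in
/-- The lamps of `f` that lie behind `p`, as seen in the direction `s`, are those of `p`. -/
def AgreesBehind (p : DLVertex) (f : ℤ → ZMod 2) : Prop := ∀ i < s.pos p, f i = s.lamp p i

variable (s) in
theorem hasTurnlessRay_iff : HasTurnlessRay p ξ ↔ ∃ γ : GeodRay DL, γ.cls = ξ ∧ γ 0 = p ∧
    ((∀ n, s.pos (γ (n + 1)) = s.pos (γ n) + 1) ∨ ∀ n, s.pos (γ (n + 1)) = s.pos (γ n) - 1) := by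
  cases s
  · rfl
  · have hpos (v : DLVertex) : left.pos v = -v.x₀.height := right.opp_pos v
    refine exists_congr fun γ => and_congr_right' (and_congr_right' ?_)
    rw [or_comm]
    simp only [hpos]
    refine or_congr ?_ ?_ <;> exact forall_congr' fun n => by omega

theorem HasLimit.hasTurnlessRay_iff (h : s.HasLimit ξ f) :
    HasTurnlessRay p ξ ↔ s.AgreesBehind p f := by
  rw [s.hasTurnlessRay_iff]
  constructor
  · rintro ⟨γ, hγ, rfl, hmono⟩
    obtain ⟨d, hd⟩ := (h.escapes hγ).exists_turnsAt
    have hd0 : d = 0 := by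
      have h0 := hd.pos_eq (0 + 1)
      have h1 := hd.pos_eq d
      have h2 := hd.pos_eq (d + 1)
      rcases hmono with hup | hdown
      · have := hup 0
        omega
      · have := hdown d
        omega
    exact fun i hi => (hd.start_eq_limit (h.escapes hγ) (by omega)).symm
  · intro hp
    have hd : 0 < 0 → f (s.pos p - (0 : ℕ)) ≠ s.lamp p (s.pos p - (0 : ℕ)) :=
      fun hlt => absurd hlt (lt_irrefl 0)
    refine ⟨s.bentRay p 0 0 f hd,
      HasLimit.unique ⟨_, rfl, escapes_bentRay hd (by simpa [AgreesBehind] using hp)⟩ h,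
      bentPath_zero, Or.inl fun n => ?_⟩
    simp only [bentRay, GeodRay.coe_ofPath, pos_bentPath]
    omega

end Direction

/-! ### Open sets of the based topology -/

namespace Direction

variable {s : Direction} {p : DLVertex} {U : Set Bdry} {ξ : Bdry} {f : ℤ → ZMod 2}

/-- Changing lamps far ahead changes a ray from `p` only after a long initial segment. -/
theorem exists_agree_mem_of_isOpen (hU : IsOpen[VisualBoundary.based DL p] U) (hξ : ξ ∈ U)
    (hf : s.HasLimit ξ f) :
    ∃ B : ℤ, ∀ ξ' x, s.HasLimit ξ' x → (∀ i < B, x i = f i) → ξ' ∈ U := by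
  obtain ⟨d, hbehind, hd⟩ := exists_depth (s := s) p hf.eventually_eq_zero
  have hγ : (s.bentRay p d 0 f hd).cls = ξ :=
    HasLimit.unique ⟨_, rfl, escapes_bentRay hd hbehind⟩ hf
  obtain ⟨N, hN⟩ := VisualBoundary.isOpen_based_iff.1 hU _ bentPath_zero (hγ ▸ hξ)
  refine ⟨max (s.pos p - d + 1) (s.pos p - 2 * d + N), fun ξ' x hx hxf => ?_⟩
  have hdx : 0 < d → x (s.pos p - d) ≠ s.lamp p (s.pos p - d) := by
    rwa [hxf _ (by omega)]
  have hbehindx : ∀ i < s.pos p - d, x i = s.lamp p i := fun i hi => by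
    rw [hxf i (by omega), hbehind i hi]
  have hγ' : (s.bentRay p d 0 x hdx).cls = ξ' :=
    HasLimit.unique ⟨_, rfl, escapes_bentRay hdx hbehindx⟩ hx
  exact hγ' ▸ hN _ bentPath_zero fun n hn => bentPath_congr fun i hi => hxf i (by omega)

/-- If the limit `ξ` is reached from `p` without turning, then a ray in the opposite direction that
has to visit a far lamp ahead of `p` before it turns shares a long initial segment with the ray
to `ξ`. -/
theorem exists_opp_mem_of_isOpen (hU : IsOpen[VisualBoundary.based DL p] U) (hξ : ξ ∈ U)
    (hf : s.HasLimit ξ f) (hp : s.AgreesBehind p f) :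
    ∃ B : ℤ, ∀ ξ' y, s.opp.HasLimit ξ' y → (∃ i < B, y i ≠ 0) → ξ' ∈ U := by
  have hd : 0 < 0 → f (s.pos p - (0 : ℕ)) ≠ s.lamp p (s.pos p - (0 : ℕ)) :=
    fun hlt => absurd hlt (lt_irrefl 0)
  have hγ : (s.bentRay p 0 0 f hd).cls = ξ :=
    HasLimit.unique ⟨_, rfl, escapes_bentRay hd (by simpa [AgreesBehind] using hp)⟩ hf
  obtain ⟨N, hN⟩ := VisualBoundary.isOpen_based_iff.1 hU _ bentPath_zero (hγ ▸ hξ)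
  obtain ⟨B, hB⟩ := eventually_atBot.1
    ((eventually_cofinite_eq_zero (s.opp.lamp p)).filter_mono atBot_le_cofinite)
  refine ⟨min B (s.opp.pos p - N), fun ξ' y hy ⟨i, hi, hyi⟩ => ?_⟩
  obtain ⟨d, hbehind, hdy⟩ := exists_depth (s := s.opp) p hy.eventually_eq_zero
  have hNd : N ≤ d := by
    by_contra hlt
    exact hyi (by rw [hbehind i (by omega), hB i (by omega)])
  have hγ' : (s.opp.bentRay p d (fun i => f (-1 - i)) y hdy).cls = ξ' :=
    HasLimit.unique ⟨_, rfl, escapes_bentRay hdy hbehind⟩ hy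
  exact hγ' ▸ hN _ bentPath_zero fun n hn => bentPath_opp_of_le (by omega)

theorem TurnsAt.of_eq {γ γ' : GeodRay DL} {d : ℕ} (hγ : s.TurnsAt γ d) (hd : 0 < d)
    (h : ∀ n ≤ 2 * d, γ' n = γ n) : s.TurnsAt γ' d := by
  have hone := hγ.pos_eq 1
  have hend := hγ.pos_eq (2 * d)
  rw [← h _ (by omega), ← h 0 (by omega)] at hone hend
  rcases s.exists_turnsAt γ' with ⟨d', hd'⟩ | ⟨d', hd'⟩ <;>
    have hone' := hd'.pos_eq 1 <;> have hend' := hd'.pos_eq (2 * d)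
  · obtain rfl : d' = d := by omega
    exact hd'
  · rw [opp_pos, opp_pos] at hone' hend'
    omega

variable (s p) in
/-- Rays from `p` to these classes have to turn, and they reveal a lamp behind `p` that differs
from `p` before they are back at the height of `p`. -/
theorem isOpen_setOf_not_agreesBehind :
    IsOpen[VisualBoundary.based DL p] {ξ | ∃ f, s.HasLimit ξ f ∧ ¬s.AgreesBehind p f} := by
  refine VisualBoundary.isOpen_based_iff.2 fun γ h0 ⟨f, hf, hbehind⟩ => ?_
  obtain ⟨d, hd⟩ := (hf.escapes rfl).exists_turnsAt
  have hend : s.pos (γ (2 * d)) = s.pos p := by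
    rw [hd.pos_eq, h0]
    omega
  have hlimit : ∀ i < s.pos p, s.lamp (γ (2 * d)) i = f i := fun i hi =>
    hd.lamp_eq_limit (hf.escapes rfl) (by omega) (by omega)
  have hpos : 0 < d := Nat.pos_of_ne_zero fun hd0 => hbehind fun i hi => by
    rw [← hlimit i hi, hd0, ← h0]
  refine ⟨2 * d + 1, fun γ' _ hγ' => ?_⟩
  have hd' : s.TurnsAt γ' d := hd.of_eq hpos fun n hn => hγ' n (by omega)
  obtain ⟨f', hf'⟩ := hd'.exists_escapes
  refine ⟨f', ⟨γ', rfl, hf'⟩, fun hbehind' => hbehind fun i hi => ?_⟩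
  rw [← hlimit i hi, ← hbehind' i hi, ← hγ' _ (by omega)]
  exact hd'.lamp_eq_limit hf' (by omega) (by rwa [hγ' _ (by omega), hend])

end Direction

/-! ### Projections to the trees -/

theorem abs_height_sub_le {v w : TreeVertex} {n : ℕ} (h : tree.edist v w ≤ n) :
    |v.height - w.height| ≤ n :=
  abs_sub_le_of_edist_le
    (fun v w hvw => by rcases hvw with rfl | rfl <;> simp [TreeVertex.height_pred]) h

theorem edist_zero_zero_le (j k : ℤ) :
    tree.edist (TreeVertex.zero j) (TreeVertex.zero k) ≤ ((j - k).natAbs : ℕ) := by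
  wlog hkj : k ≤ j generalizing j k
  · rw [SimpleGraph.edist_comm, ← Int.natAbs_neg, neg_sub]
    exact this k j (by omega)
  obtain ⟨q, hq⟩ := tree_walk_down j (j - k).natAbs
  have hle := SimpleGraph.edist_le q
  rwa [hq, Int.natAbs_of_nonneg (by omega), sub_sub_cancel] at hle

/-- A path in the tree with strictly monotone heights, as a geodesic ray. -/
def GeodRay.ofHeight (x : ℕ → TreeVertex) (hx : ∀ n, tree.Adj (x n) (x (n + 1)))
    (hh : (∀ n : ℕ, (x n).height = (x 0).height + n) ∨
      ∀ n : ℕ, (x n).height = (x 0).height - n) : GeodRay tree :=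
  GeodRay.ofPath x hx fun m n C _ hC => by
    have := abs_le.1 (abs_height_sub_le hC)
    rcases hh with hh | hh <;> rw [hh m, hh n] at this <;> omega

theorem ApproachesEnd.tendsto_height_atBot {x : ℕ → TreeVertex} (h : ApproachesEnd x omegaEnd) :
    Tendsto (fun n => (x n).height) atTop atBot := by
  obtain ⟨N, ρ, hρ, hx⟩ := h
  obtain ⟨C, hC⟩ := GeodRay.cls_eq_iff.1 hρ
  refine tendsto_atBot.2 fun b => ?_
  filter_upwards [eventually_ge_atTop (N + (C - b).toNat)] with n hn
  obtain ⟨m, rfl⟩ := Nat.exists_eq_add_of_le (show N ≤ n by omega)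
  have hheight : (downRay m).height = -m := rfl
  have := abs_le.1 (abs_height_sub_le (hC m))
  rw [hheight, ← hx] at this
  omega

namespace Direction

variable {s : Direction} {v w : DLVertex} {γ : GeodRay DL} {d : ℕ} {ξ : Bdry}

/-- The projection to the tree whose heights are the positions of the lamplighter, as seen in the
direction `s`. -/
def proj : Direction → DLVertex → TreeVertex
  | right => DLVertex.x₀
  | left => DLVertex.x₁

theorem height_proj (s : Direction) (v : DLVertex) : (s.proj v).height = s.pos v := by
  cases s
  · rfl
  · exact eq_neg_of_add_eq_zero_right v.height_add

theorem label_proj (v : DLVertex) {i : ℤ} (hi : i < s.pos v) :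
    (s.proj v).label i = s.lamp v i := by
  have hv := v.height_add
  rw [← height_proj] at hi
  cases s
  · change _ = (v.x₀.label + L2.reflect v.x₁.label) i
    change i < v.x₀.height at hi
    simp [v.x₁.label_eq_zero (-1 - i) (by omega), proj]
  · change _ = L2.reflect (v.x₀.label + L2.reflect v.x₁.label) i
    change i < v.x₁.height at hi
    simp [v.x₀.label_eq_zero (-1 - i) (by omega), proj]

theorem adj_proj (s : Direction) (h : DL.Adj v w) : tree.Adj (s.proj v) (s.proj w) := by
  cases s
  · exact h.1
  · exact h.2

theorem proj_eq_zero (hv : ∀ i < s.pos v, s.lamp v i = 0) :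
    s.proj v = TreeVertex.zero (s.pos v) := by
  ext i
  · exact s.height_proj v
  · rcases lt_or_ge i (s.pos v) with hi | hi
    · rw [label_proj v hi, hv i hi]
      rfl
    · rw [(s.proj v).label_eq_zero i (by rwa [height_proj])]
      rfl

theorem TurnsAt.exists_approachesEnd (hγ : s.TurnsAt γ d) :
    ∃ e, e ≠ omegaEnd ∧ ApproachesEnd (fun n => s.proj (γ n)) e := by
  let ρ := GeodRay.ofHeight (fun n => s.proj (γ (d + n))) (fun n => s.adj_proj (γ.adj _))
    (Or.inl fun n => by
      rw [height_proj, height_proj, hγ.pos_eq, hγ.pos_eq (d + 0)]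
      omega)
  have happroach : ApproachesEnd (fun n => s.proj (γ n)) ρ.cls := ⟨d, ρ, rfl, fun _ => rfl⟩
  refine ⟨ρ.cls, fun he => ?_, happroach⟩
  rw [he] at happroach
  have hbot := happroach.tendsto_height_atBot
  simp only [height_proj] at hbot
  exact hγ.tendsto_pos.not_tendsto disjoint_atTop_atBot hbot

theorem TurnsAt.approachesEnd_omegaEnd (hγ : s.TurnsAt γ d) :
    ApproachesEnd (fun n => s.opp.proj (γ n)) omegaEnd := by
  obtain ⟨B, hB⟩ := eventually_atTop.1
    ((eventually_cofinite_eq_zero (s.lamp (γ 0))).filter_mono atTop_le_cofinite)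
  obtain ⟨N, hN⟩ := eventually_atTop.1
    ((eventually_ge_atTop d).and (hγ.tendsto_pos.eventually_ge_atTop (max B (s.pos (γ 0)))))
  have hpos (n : ℕ) : s.opp.pos (γ (N + n)) = s.opp.pos (γ N) - n := by
    have := (hN N le_rfl).1
    rw [opp_pos, opp_pos, hγ.pos_eq, hγ.pos_eq N]
    omega
  have hzero (n : ℕ) : s.opp.proj (γ (N + n)) = TreeVertex.zero (s.opp.pos (γ N) - n) := by
    rw [← hpos]
    refine proj_eq_zero fun i hi => ?_
    have := (hN (N + n) (N.le_add_right n)).2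
    rw [opp_pos] at hi
    rw [opp_lamp, hγ.lamp_eq_start _ (Or.inr (by omega)), hB _ (by omega)]
  let ρ := GeodRay.ofHeight (fun n => s.opp.proj (γ (N + n))) (fun n => s.opp.adj_proj (γ.adj _))
    (Or.inr fun n => by rw [height_proj, height_proj, hpos, hpos 0]; simp)
  refine ⟨N, ρ, GeodRay.cls_eq_iff.2 ⟨(s.opp.pos (γ N)).natAbs, fun n => ?_⟩, fun _ => rfl⟩
  have hle := edist_zero_zero_le (s.opp.pos (γ N) - n) (-n)
  rwa [← hzero, sub_neg_eq_add, sub_add_cancel] at hle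

/-- The half `∂₊` or `∂₋` of the boundary in which the lamplighter is at `+∞`, as seen in the
direction `s`. -/
def bdry : Direction → Set Bdry
  | right => bdryPlus
  | left => bdryMinus

theorem mem_bdry_iff_approachesEnd : ξ ∈ s.bdry ↔ ∃ γ : GeodRay DL, γ.cls = ξ ∧
    (∃ e, e ≠ omegaEnd ∧ ApproachesEnd (fun n => s.proj (γ n)) e) ∧
      ApproachesEnd (fun n => s.opp.proj (γ n)) omegaEnd := by
  cases s <;> rfl

theorem mem_bdry_iff : ξ ∈ s.bdry ↔ ∃ f, s.HasLimit ξ f := by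
  rw [mem_bdry_iff_approachesEnd]
  constructor
  · rintro ⟨γ, rfl, -, homega⟩
    have hbot := homega.tendsto_height_atBot
    simp only [height_proj, opp_pos, tendsto_neg_atBot_iff] at hbot
    rcases s.exists_turnsAt γ with ⟨d, hd⟩ | ⟨d, hd⟩
    · exact hd.exists_escapes.imp fun f hf => ⟨γ, rfl, hf⟩
    · have hopp := hd.tendsto_pos
      simp only [opp_pos, tendsto_neg_atTop_iff] at hopp
      exact absurd hbot (hopp.not_tendsto disjoint_atBot_atTop)
  · rintro ⟨f, γ, rfl, hf⟩
    obtain ⟨d, hd⟩ := hf.exists_turnsAt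
    exact ⟨γ, rfl, hd.exists_approachesEnd, hd.approachesEnd_omegaEnd⟩

end Direction

/-! ### The action on limits -/

namespace L2

variable {h : L2}

theorem pow_pos (h : L2) (n : ℕ) : (h ^ n).pos = n * h.pos := by
  induction n with
  | zero => simp
  | succ n ih =>
    rw [pow_succ, mul_pos, ih]
    push_cast
    ring

theorem pow_lamps (h : L2) (n : ℕ) (i : ℤ) :
    (h ^ n).lamps i = ∑ m ∈ Finset.range n, h.lamps (i - m * h.pos) := by
  induction n with
  | zero => simp
  | succ n ih => simp [pow_succ, ih, pow_pos, Finset.sum_range_succ]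

theorem exists_lamps_limit (hpos : 0 < h.pos) : ∃ f : ℤ → ZMod 2,
    (∀ i, ∀ᶠ n : ℕ in atTop, (h ^ n).lamps i = f i) ∧ ∀ᶠ i in atBot, f i = 0 := by
  obtain ⟨B, hB⟩ := eventually_atBot.1
    ((eventually_cofinite_eq_zero h.lamps).filter_mono atBot_le_cofinite)
  refine ⟨fun i => (h ^ (i - B).toNat).lamps i, fun i => ?_, ?_⟩
  · filter_upwards [eventually_ge_atTop (i - B).toNat] with n hn
    rw [pow_lamps, pow_lamps]
    exact Finset.eventually_constant_sum (fun m hm => hB _ (by nlinarith [Int.toNat_le.1 hm])) hn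
  · filter_upwards [eventually_le_atBot B] with i hi
    simp [Int.toNat_of_nonpos (sub_nonpos.2 hi)]

theorem lamps_limit_eq {f : ℤ → ZMod 2}
    (hf : ∀ i, ∀ᶠ n : ℕ in atTop, (h ^ n).lamps i = f i) (i : ℤ) :
    h.lamps i + f (i - h.pos) = f i := by
  obtain ⟨n, hn, hn'⟩ :=
    (((tendsto_add_atTop_nat 1).eventually (hf i)).and (hf (i - h.pos))).exists
  rw [← hn, ← hn', pow_succ']
  simp

end L2

namespace Direction

variable {s : Direction} {g : L2} {α ξ : Bdry} {f x : ℤ → ZMod 2}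

/-- The distance by which `g` moves the lamplighter ahead, as seen in the direction `s`; in the
direction `right` this is `g.expT`. -/
def drift (s : Direction) (g : L2) : ℤ := (s.aut g).pos

theorem drift_opp (s : Direction) (g : L2) : s.opp.drift g = -s.drift g := by
  simp [drift, aut_opp]

theorem drift_inv (s : Direction) (g : L2) : s.drift g⁻¹ = -s.drift g := by
  simp [drift]

theorem drift_pow (s : Direction) (g : L2) (n : ℕ) : s.drift (g ^ n) = n * s.drift g := by
  simp [drift, L2.pow_pos]

theorem exists_drift_pos (hg : g.expT ≠ 0) : ∃ s : Direction, 0 < s.drift g :=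
  hg.lt_or_gt.elim (fun hneg => ⟨left, neg_pos.2 hneg⟩) fun hpos => ⟨right, hpos⟩

namespace HasLimit

theorem smul (hξ : s.HasLimit ξ x) (g : L2) :
    s.HasLimit (g • ξ) fun i => (s.aut g).lamps i + x (i - s.drift g) := by
  obtain ⟨γ, rfl, hlamp, hpos⟩ := hξ
  refine ⟨GeodRay.map g.toIso γ, rfl, fun i => ?_, ?_⟩
  · filter_upwards [hlamp (i - s.drift g)] with n hn
    rw [← hn]
    simp [GeodRay.map, lamp, coord_toIso, drift]
  · simpa [GeodRay.map, pos, coord_toIso, drift] using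
      tendsto_atTop_add_const_left _ (s.drift g) hpos

theorem exists_smul (hξ : s.HasLimit ξ x) (hα : s.HasLimit α f) (hg : g • α = α) :
    ∃ x', s.HasLimit (g • ξ) x' ∧
      ∀ i, x' i = f i ↔ x (i - s.drift g) = f (i - s.drift g) := by
  have hfix : ∀ i, f i = (s.aut g).lamps i + f (i - s.drift g) :=
    congrFun (hα.limit_unique (hg ▸ hα.smul g))
  exact ⟨_, hξ.smul g, fun i => by rw [hfix i, add_right_inj]⟩

theorem smul_ne_self (hξ : s.HasLimit ξ x) (hg : g ≠ 1) (h0 : s.drift g = 0) : g • ξ ≠ ξ := by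
  intro hfix
  have hx := hξ.smul g
  rw [hfix] at hx
  refine hg ((map_eq_one_iff s.aut s.aut.injective).1 (L2.ext (Finsupp.ext fun i => ?_) h0))
  simpa [h0] using congrFun (hx.limit_unique hξ) i

end HasLimit

/-! ### Power limits -/

theorem hasLampStand_atBot_iff :
    HasLampStand ξ f atBot ↔ left.HasLimit ξ fun i => f (-1 - i) := by
  have hlamp (v : DLVertex) (i : ℤ) : left.lamp v i = right.lamp v (-1 - i) := right.opp_lamp v i
  refine exists_congr fun γ => and_congr_right' (and_congr ?_ tendsto_neg_atTop_iff.symm)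
  simp only [hlamp]
  exact (Equiv.subLeft (-1 : ℤ)).surjective.forall

theorem isPowerLimit_iff (hg : 0 < s.drift g) : IsPowerLimit g ξ ↔
    ∃ f, (∀ i, ∀ᶠ n : ℕ in atTop, (s.aut g ^ n).lamps i = f i) ∧ s.HasLimit ξ f := by
  cases s
  · have hpos : 0 < g.expT := hg
    simp only [IsPowerLimit, hpos, hpos.not_gt, true_and, false_and, or_false]
    rfl
  · have hneg : g.expT < 0 := neg_pos.1 hg
    simp only [IsPowerLimit, hneg, hneg.not_gt, true_and, false_and, false_or]
    refine ((Equiv.subLeft (-1 : ℤ)).arrowCongr (Equiv.refl (ZMod 2))).exists_congr fun f => ?_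
    refine and_congr ?_ (hasLampStand_atBot_iff.trans (iff_of_eq (congrArg _ ?_)))
    · rw [(Equiv.subLeft (-1 : ℤ)).surjective.forall]
      simp [aut, ← map_pow, neg_add_eq_sub]
    · ext i
      simp [neg_add_eq_sub]

theorem exists_isPowerLimit_iff_eq (hg : 0 < s.drift g) :
    ∃ α f, (∀ ξ, IsPowerLimit g ξ ↔ ξ = α) ∧ g • α = α ∧ s.HasLimit α f := by
  obtain ⟨f, hlim, hzero⟩ := L2.exists_lamps_limit hg
  obtain ⟨α, hα⟩ := s.exists_hasLimit_of_eventually_eq_zero hzero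
  refine ⟨α, f, fun ξ => (isPowerLimit_iff hg).trans ⟨?_, ?_⟩, ?_, hα⟩
  · rintro ⟨x, hx, hξ⟩
    obtain rfl : x = f := funext fun i => by
      obtain ⟨n, hn, hn'⟩ := ((hx i).and (hlim i)).exists
      rw [← hn, hn']
    exact hξ.unique hα
  · rintro rfl
    exact ⟨f, hlim, hα⟩
  · exact HasLimit.unique (by simpa only [drift, L2.lamps_limit_eq hlim] using hα.smul g) hα

end Direction

/-! ### North-south dynamics -/

namespace NorthSouth

variable {τ τ' : TopologicalSpace Bdry} {g : L2} {α ρ : Bdry}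

theorem inv (h : NorthSouth τ g α ρ) : NorthSouth τ g⁻¹ ρ α := by
  obtain ⟨hne, hα, hρ, hfwd, hbwd, hunif⟩ := h
  refine ⟨hne.symm, inv_smul_eq_iff.2 hρ.symm, inv_smul_eq_iff.2 hα.symm, hbwd, ?_,
    fun U V hU hV hρU hαV => ?_⟩
  · simpa only [inv_inv] using hfwd
  · simpa only [inv_inv, and_comm] using hunif V U hV hU hαV hρU

theorem mono (h : NorthSouth τ g α ρ) (hle : τ ≤ τ') : NorthSouth τ' g α ρ := by
  obtain ⟨hne, hα, hρ, hfwd, hbwd, hunif⟩ := h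
  exact ⟨hne, hα, hρ, fun ξ hξ => (hfwd ξ hξ).mono_right (nhds_mono hle),
    fun ξ hξ => (hbwd ξ hξ).mono_right (nhds_mono hle),
    fun U V hU hV => hunif U V (hle U hU) (hle V hV)⟩

end NorthSouth

namespace Direction

variable {s : Direction} {g : L2} {α ρ ξ : Bdry} {f f' : ℤ → ZMod 2} {p : DLVertex} {B B' : ℤ}

/-- The basin of attraction of level `B` of the class with limit `f` in the direction `s`: the
classes in that direction whose lamps agree with `f` before `-B`, and the classes in the opposite
direction whose lamps differ from `f'` before `B`. Basins decrease to the class with limit `f` as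
`B` tends to `-∞`, and they increase to everything but the class with limit `f'` as `B` tends to
`+∞`. -/
def basin (s : Direction) (f f' : ℤ → ZMod 2) (B : ℤ) : Set Bdry :=
  {ξ | (∃ x, s.HasLimit ξ x ∧ ∀ i < -B, x i = f i) ∨
    ∃ y, s.opp.HasLimit ξ y ∧ ∃ i < B, y i ≠ f' i}

theorem basin_mono (h : B ≤ B') : s.basin f f' B ⊆ s.basin f f' B' := by
  rintro ξ (⟨x, hx, hxf⟩ | ⟨y, hy, i, hi, hyf⟩)
  · exact Or.inl ⟨x, hx, fun i hi => hxf i (by omega)⟩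
  · exact Or.inr ⟨y, hy, i, by omega, hyf⟩

theorem mem_basin_of_notMem_opp (h : ξ ∉ s.opp.basin f' f B) : ξ ∈ s.basin f f' (-B) := by
  simp only [basin, opp_opp, Set.mem_ofPred_eq, not_or, not_exists, not_and, not_forall,
    not_not] at h
  rcases s.exists_hasLimit ξ with ⟨x, hx⟩ | ⟨y, hy⟩
  · exact Or.inl ⟨x, hx, fun i hi => h.2 x hx i (by omega)⟩
  · obtain ⟨i, hi, hne⟩ := h.1 y hy
    exact Or.inr ⟨y, hy, i, hi, hne⟩

theorem exists_mem_basin (hα : s.HasLimit α f) (hρ : s.opp.HasLimit ρ f') (hξ : ξ ≠ ρ) :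
    ∃ B, ξ ∈ s.basin f f' B := by
  rcases s.exists_hasLimit ξ with ⟨x, hx⟩ | ⟨y, hy⟩
  · obtain ⟨b, hb⟩ := eventually_atBot.1 (hx.eventually_eq_zero.and hα.eventually_eq_zero)
    refine ⟨-b, Or.inl ⟨x, hx, fun i hi => ?_⟩⟩
    rw [(hb i (by omega)).1, (hb i (by omega)).2]
  · obtain ⟨i, hi⟩ : ∃ i, y i ≠ f' i := by
      by_contra! heq
      exact hξ (hy.unique (funext heq ▸ hρ))
    exact ⟨i + 1, Or.inr ⟨y, hy, i, by omega, hi⟩⟩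

theorem exists_basin_subset {U : Set Bdry} (hα : s.HasLimit α f) (hρ : s.opp.HasLimit ρ f')
    (hp : s.AgreesBehind p f) (hU : IsOpen[VisualBoundary.based DL p] U) (hαU : α ∈ U) :
    ∃ B, s.basin f f' B ⊆ U := by
  obtain ⟨B₁, hB₁⟩ := exists_agree_mem_of_isOpen hU hαU hα
  obtain ⟨B₂, hB₂⟩ := exists_opp_mem_of_isOpen hU hαU hα hp
  obtain ⟨b, hb⟩ := eventually_atBot.1 hρ.eventually_eq_zero
  refine ⟨min (-B₁) (min B₂ b), ?_⟩
  rintro ξ (⟨x, hx, hxf⟩ | ⟨y, hy, i, hi, hyf⟩)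
  · exact hB₁ ξ x hx fun i hi => hxf i (by omega)
  · exact hB₂ ξ y hy ⟨i, by omega, by rwa [← hb i (by omega)]⟩

variable (s g α ρ f f') in
/-- The element `g` moves the lamplighter in the direction `s` and fixes the classes `α` and `ρ`,
which have the limits `f` in the direction `s` and `f'` in the opposite direction. -/
structure FixedPair : Prop where
  drift_pos : 0 < s.drift g
  smul_fst : g • α = α
  smul_snd : g • ρ = ρ
  hasLimit_fst : s.HasLimit α f
  hasLimit_snd : s.opp.HasLimit ρ f'

theorem exists_fixedPair (hg : 0 < s.drift g) : ∃ α ρ f f', (∀ ξ, IsPowerLimit g ξ ↔ ξ = α) ∧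
    (∀ ξ, IsPowerLimit g⁻¹ ξ ↔ ξ = ρ) ∧ s.FixedPair g α ρ f f' := by
  have hg' : 0 < s.opp.drift g⁻¹ := by rwa [drift_inv, drift_opp, neg_neg]
  obtain ⟨α, f, hpow, hfix, hα⟩ := exists_isPowerLimit_iff_eq hg
  obtain ⟨ρ, f', hpow', hfix', hρ⟩ := exists_isPowerLimit_iff_eq hg'
  exact ⟨α, ρ, f, f', hpow, hpow', hg, hfix, (inv_smul_eq_iff.1 hfix').symm, hα, hρ⟩

namespace FixedPair

theorem symm (h : s.FixedPair g α ρ f f') : s.opp.FixedPair g⁻¹ ρ α f' f where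
  drift_pos := by simpa only [drift_inv, drift_opp, neg_neg] using h.drift_pos
  smul_fst := inv_smul_eq_iff.2 h.smul_snd.symm
  smul_snd := inv_smul_eq_iff.2 h.smul_fst.symm
  hasLimit_fst := h.hasLimit_snd
  hasLimit_snd := by simpa only [opp_opp] using h.hasLimit_fst

theorem ne (h : s.FixedPair g α ρ f f') : α ≠ ρ := fun heq =>
  h.hasLimit_fst.not_opp (heq ▸ h.hasLimit_snd)

theorem pow_smul_mem_basin (h : s.FixedPair g α ρ f f') (hξ : ξ ∈ s.basin f f' B) (n : ℕ) :
    g ^ n • ξ ∈ s.basin f f' (B - n * s.drift g) := by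
  rw [← drift_pow]
  rcases hξ with ⟨x, hx, hxf⟩ | ⟨y, hy, i, hi, hyf⟩
  · obtain ⟨x', hx', hiff⟩ := hx.exists_smul h.hasLimit_fst
      ((MulAction.stabilizer L2 α).pow_mem h.smul_fst n)
    exact Or.inl ⟨x', hx', fun i hi => (hiff i).2 (hxf _ (by omega))⟩
  · obtain ⟨y', hy', hiff⟩ := hy.exists_smul h.hasLimit_snd
      ((MulAction.stabilizer L2 ρ).pow_mem h.smul_snd n)
    refine Or.inr ⟨y', hy', i - s.drift (g ^ n), by omega, fun heq => hyf ?_⟩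
    simpa [drift_opp] using (hiff _).1 heq

theorem exists_forall_pow_smul_mem_basin (h : s.FixedPair g α ρ f f') (B B' : ℤ) :
    ∃ N : ℕ, ∀ n ≥ N, ∀ ξ ∈ s.basin f f' B, g ^ n • ξ ∈ s.basin f f' B' :=
  ⟨(B - B').toNat, fun n hn _ hξ =>
    basin_mono (by nlinarith [Int.toNat_le.1 hn, h.drift_pos]) (h.pow_smul_mem_basin hξ n)⟩

theorem tendsto_of_basin_subset {τ : TopologicalSpace Bdry} (h : s.FixedPair g α ρ f f')
    (hα : ∀ U, IsOpen[τ] U → α ∈ U → ∃ B, s.basin f f' B ⊆ U) (hξ : ξ ≠ ρ) :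
    Tendsto (fun n : ℕ => g ^ n • ξ) atTop (@nhds Bdry τ α) := by
  refine (@tendsto_nhds _ τ ..).2 fun U hU hαU => ?_
  obtain ⟨B, hB⟩ := exists_mem_basin h.hasLimit_fst h.hasLimit_snd hξ
  obtain ⟨B', hB'⟩ := hα U hU hαU
  obtain ⟨N, hN⟩ := h.exists_forall_pow_smul_mem_basin B B'
  exact eventually_atTop.2 ⟨N, fun n hn => hB' (hN n hn ξ hB)⟩

theorem exists_forall_pow_smul_mem {U V : Set Bdry} (h : s.FixedPair g α ρ f f')
    (hU : s.basin f f' B ⊆ U) (hV : s.opp.basin f' f B' ⊆ V) :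
    ∃ N : ℕ, ∀ n ≥ N, ∀ ξ, ξ ∉ V → g ^ n • ξ ∈ U := by
  obtain ⟨N, hN⟩ := h.exists_forall_pow_smul_mem_basin (-B') B
  exact ⟨N, fun n hn ξ hξ => hU (hN n hn ξ (mem_basin_of_notMem_opp fun hmem => hξ (hV hmem)))⟩

theorem northSouth_of_basin_subset {τ : TopologicalSpace Bdry} (h : s.FixedPair g α ρ f f')
    (hα : ∀ U, IsOpen[τ] U → α ∈ U → ∃ B, s.basin f f' B ⊆ U)
    (hρ : ∀ V, IsOpen[τ] V → ρ ∈ V → ∃ B, s.opp.basin f' f B ⊆ V) : NorthSouth τ g α ρ := by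
  refine ⟨h.ne, h.smul_fst, h.smul_snd, fun ξ hξ => h.tendsto_of_basin_subset hα hξ,
    fun ξ hξ => h.symm.tendsto_of_basin_subset hρ hξ, fun U V hU hV hαU hρV => ?_⟩
  obtain ⟨B, hB⟩ := hα U hU hαU
  obtain ⟨B', hB'⟩ := hρ V hV hρV
  obtain ⟨N, hN⟩ := h.exists_forall_pow_smul_mem hB hB'
  obtain ⟨N', hN'⟩ := h.symm.exists_forall_pow_smul_mem (V := U) hB' (by rwa [opp_opp])
  exact ⟨max N N', fun n hn =>
    ⟨hN n (le_of_max_le_left hn), hN' n (le_of_max_le_right hn)⟩⟩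

theorem tendsto_of_hasLimit (h : s.FixedPair g α ρ f f') {x : ℤ → ZMod 2} (hξ : s.HasLimit ξ x)
    (p : DLVertex) :
    Tendsto (fun n : ℕ => g ^ n • ξ) atTop (@nhds Bdry (VisualBoundary.based DL p) α) := by
  refine (@tendsto_nhds _ (VisualBoundary.based DL p) ..).2 fun U hU hαU => ?_
  obtain ⟨B', hB'⟩ := exists_agree_mem_of_isOpen hU hαU h.hasLimit_fst
  have hne : ξ ≠ ρ := fun heq => hξ.not_opp (heq ▸ h.hasLimit_snd)
  obtain ⟨B, hB⟩ := exists_mem_basin h.hasLimit_fst h.hasLimit_snd hne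
  obtain ⟨N, hN⟩ := h.exists_forall_pow_smul_mem_basin B (-B')
  refine eventually_atTop.2 ⟨N, fun n hn => ?_⟩
  rcases hN n hn ξ hB with ⟨x', hx', hagree⟩ | ⟨y, hy, -⟩
  · exact hB' _ x' hx' (by rwa [neg_neg] at hagree)
  · exact absurd hy (hξ.smul (g ^ n)).not_opp

theorem halfAttraction (h : s.FixedPair g α ρ f f') :
    HalfAttraction g α ρ s.bdry s.opp.bdry := by
  refine ⟨mem_bdry_iff.2 ⟨f, h.hasLimit_fst⟩, mem_bdry_iff.2 ⟨f', h.hasLimit_snd⟩,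
    fun p => ⟨fun ξ hξ => ?_, fun ξ hξ => ?_⟩⟩
  · obtain ⟨x, hx⟩ := mem_bdry_iff.1 hξ
    exact h.tendsto_of_hasLimit hx p
  · obtain ⟨y, hy⟩ := mem_bdry_iff.1 hξ
    exact h.symm.tendsto_of_hasLimit hy p

theorem northSouth_of_agreesBehind (h : s.FixedPair g α ρ f f') (hf : s.AgreesBehind p f)
    (hf' : s.opp.AgreesBehind p f') : NorthSouth (VisualBoundary.based DL p) g α ρ :=
  h.northSouth_of_basin_subset
    (fun _ => exists_basin_subset h.hasLimit_fst h.hasLimit_snd hf)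
    (fun _ => exists_basin_subset h.symm.hasLimit_fst h.symm.hasLimit_snd hf')

/-- Otherwise `α` has a neighbourhood that consists of classes in the direction `s` only. -/
theorem agreesBehind_of_northSouth (h : s.FixedPair g α ρ f f')
    (hns : NorthSouth (VisualBoundary.based DL p) g α ρ) : s.AgreesBehind p f := by
  by_contra hbehind
  let y := Function.update f' 0 (f' 0 + 1)
  have hzero : ∀ᶠ i in atBot, y i = 0 := by
    filter_upwards [h.hasLimit_snd.eventually_eq_zero, eventually_lt_atBot 0] with i hi hlt
    simpa only [y, Function.update_of_ne hlt.ne] using hi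
  obtain ⟨ξ, hξ⟩ := s.opp.exists_hasLimit_of_eventually_eq_zero hzero
  have hne : ξ ≠ ρ := by
    rintro rfl
    simpa [y] using congrFun (hξ.limit_unique h.hasLimit_snd) 0
  have hattract : ∀ᶠ n : ℕ in atTop, ∃ x, s.HasLimit (g ^ n • ξ) x ∧ ¬s.AgreesBehind p x :=
    (@tendsto_nhds _ (VisualBoundary.based DL p) ..).1 (hns.2.2.2.1 ξ hne) _
      (isOpen_setOf_not_agreesBehind s p) ⟨f, h.hasLimit_fst, hbehind⟩
  obtain ⟨n, x, hx, -⟩ := hattract.exists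
  exact hx.not_opp (hξ.smul (g ^ n))

theorem northSouth_iff (h : s.FixedPair g α ρ f f') :
    NorthSouth (VisualBoundary.based DL p) g α ρ ↔ HasTurnlessRay p α ∧ HasTurnlessRay p ρ := by
  rw [h.hasLimit_fst.hasTurnlessRay_iff, h.hasLimit_snd.hasTurnlessRay_iff]
  exact ⟨fun hns => ⟨h.agreesBehind_of_northSouth hns, h.symm.agreesBehind_of_northSouth hns.inv⟩,
    fun hp => h.northSouth_of_agreesBehind hp.1 hp.2⟩

theorem exists_hasTurnlessRay (h : s.FixedPair g α ρ f f') :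
    ∃ p, HasTurnlessRay p α ∧ HasTurnlessRay p ρ := by
  simp only [h.hasLimit_fst.hasTurnlessRay_iff, h.hasLimit_snd.hasTurnlessRay_iff]
  obtain ⟨b, hb⟩ := eventually_atBot.1
    (h.hasLimit_fst.eventually_eq_zero.and h.hasLimit_snd.eventually_eq_zero)
  refine ⟨s.vertex (overwrite 0 (Finset.Ico b (-b)) fun i => if i < 0 then f i else f' (-1 - i)) 0,
    fun i hi => ?_, fun i hi => ?_⟩
  · rw [pos_vertex] at hi
    simp only [lamp_vertex, overwrite_apply, Finset.mem_Ico, if_pos hi]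
    split_ifs
    · rfl
    · exact (hb i (by omega)).1
  · rw [opp_pos, pos_vertex] at hi
    simp only [opp_lamp, lamp_vertex, overwrite_apply, Finset.mem_Ico, sub_sub_cancel,
      if_neg (show ¬-1 - i < 0 by omega)]
    split_ifs
    · rfl
    · exact (hb i (by omega)).2

end FixedPair

end Direction

/-! ### Elements that return the lamplighter -/

namespace L2

open Direction

variable {g : L2}

theorem smul_smul_self (hg : g.expT = 0) (ξ : Bdry) : g • g • ξ = ξ := by
  have hpos : g.pos = 0 := hg
  have hsq : g * g = 1 := L2.ext (Finsupp.ext fun i => by simp [hpos, CharTwo.add_self_eq_zero])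
    (by simp [hpos])
  rw [smul_smul, hsq, one_smul]

theorem smul_ne_self (hg : g ≠ 1) (h0 : g.expT = 0) (ξ : Bdry) : g • ξ ≠ ξ := by
  have hdrift : right.drift g = 0 := h0
  rcases right.exists_hasLimit ξ with ⟨x, hx⟩ | ⟨y, hy⟩
  · exact hx.smul_ne_self hg hdrift
  · exact hy.smul_ne_self hg (by rw [drift_opp, hdrift, neg_zero])

theorem orderOf_toPerm_eq_two (hg : g ≠ 1) (h0 : g.expT = 0) :
    orderOf (MulAction.toPerm g : Equiv.Perm Bdry) = 2 := by
  obtain ⟨ξ, -⟩ := right.exists_hasLimit_of_eventually_eq_zero (f := 0) (.of_forall fun _ => rfl)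
  refine orderOf_eq_prime (Equiv.ext fun ξ => ?_) fun heq => smul_ne_self hg h0 ξ ?_
  · rw [sq]
    exact smul_smul_self h0 ξ
  · exact congrArg (fun σ : Equiv.Perm Bdry => σ ξ) heq

theorem minimalPeriod_smul_eq_two (hg : g ≠ 1) (h0 : g.expT = 0) (ξ : Bdry) :
    Function.minimalPeriod (fun η : Bdry => g • η) ξ = 2 :=
  Function.minimalPeriod_eq_prime (smul_smul_self h0 ξ) (smul_ne_self hg h0 ξ)

end L2

end

theorem theorem4p14 (g : L2) (hg : g ≠ 1) :
    (g.expT = 0 →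
      orderOf (MulAction.toPerm g : Equiv.Perm Bdry) = 2 ∧
        ∀ ξ : Bdry, Function.minimalPeriod (fun η : Bdry => g • η) ξ = 2) ∧
    (g.expT ≠ 0 →
      ∃ α ρ : Bdry,
        (∀ ξ, IsPowerLimit g ξ ↔ ξ = α) ∧
        (∀ ξ, IsPowerLimit g⁻¹ ξ ↔ ξ = ρ) ∧
        NorthSouth (VisualBoundary.unbased DL) g α ρ ∧
        (0 < g.expT → HalfAttraction g α ρ bdryPlus bdryMinus) ∧
        (g.expT < 0 → HalfAttraction g α ρ bdryMinus bdryPlus) ∧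
        (∀ p : DLVertex, NorthSouth (VisualBoundary.based DL p) g α ρ ↔
          HasTurnlessRay p α ∧ HasTurnlessRay p ρ) ∧
        (∃ p : DLVertex, HasTurnlessRay p α ∧ HasTurnlessRay p ρ)) := by
  refine ⟨fun h0 => ⟨L2.orderOf_toPerm_eq_two hg h0, L2.minimalPeriod_smul_eq_two hg h0⟩,
    fun hne => ?_⟩
  obtain ⟨s, hs⟩ := Direction.exists_drift_pos hne
  obtain ⟨α, ρ, f, f', hα, hρ, hpair⟩ := Direction.exists_fixedPair hs
  obtain ⟨p, hp⟩ := hpair.exists_hasTurnlessRay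
  refine ⟨α, ρ, hα, hρ, (hpair.northSouth_iff.2 hp).mono (VisualBoundary.based_le_unbased p),
    fun hpos => ?_, fun hneg => ?_, fun p => hpair.northSouth_iff, p, hp⟩
  · cases s with
    | right => exact hpair.halfAttraction
    | left => exact absurd hpos (neg_pos.1 hs).not_gt
  · cases s with
    | right => exact absurd hneg hs.not_gt
    | left => exact hpair.halfAttraction
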